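/- A partition of $[n]=\{1,\dots,n\}$ with blocks $B_1,\dots,B_d$, listed so that $\min B_1<\dots<\min B_d$, is represented by its canonical sequence $\pi=\pi_1\pi_2\cdots\pi_n$, where $\pi_i=k$ if and only if $i\in B_k$. A partition $\pi$ of $[n]$ contains a partition $\sigma=\sigma_1\cdots\sigma_m$ of $[m]$ if there are indices $1\le f(1)<\dots<f(m)\le n$ such that, for all $i,j\in[m]$, $\pi_{f(i)}<\pi_{f(j)}$ if and only if $\sigma_i<\sigma_j$; otherwise $\pi$ avoids $\sigma$. Let $p(n;\sigma)$ be the number of partitions of $[n]$ that avoid $\sigma$, and write $\sigma\sim\sigma'$ if $p(n;\sigma)=p(n;\sigma')$ for every $n$. In the patterns below, which are given by their canonical sequences, $k^d$ denotes $d$ consecutive copies of the symbol $k$. Theorem. For all integers $p,q\ge 0$, the following equivalences hold: 1. $1232^{p}142^{q}\sim 12312^{p}42^{q}$; 2. $1232^{p}412^{q}\sim 1232^{p}42^{q}1$; 3. $123^{p+1}413^{q}\sim 12343^{p}13^{q}$; 4. $123^{p+1}143^{q}\sim 123^{p+1}13^{q}4$. -/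

import Mathlib

open Finset

namespace SetPartition

/-- A (set) partition of `[n]`, with `[n]` modelled by `Fin n`. -/
abbrev Part (n : ℕ) : Type := Finpartition (univ : Finset (Fin n))

/-- The canonical sequence of a partition: `canonicalSeq π i = k` if and only if `i` lies in the
`k`-th block (counting from 1), where the blocks are listed in increasing order of their minima.
The position of a block in that list is the number of blocks whose minimum is at most its own. -/
def canonicalSeq {n : ℕ} (π : Part n) (i : Fin n) : ℕ :=
  #{B ∈ π.parts | B.min ≤ (π.part i).min}

/-- The sequence `s` has a subsequence that is order-isomorphic to `t`. -/
def ContainsSeq {n m : ℕ} (s : Fin n → ℕ) (t : Fin m → ℕ) : Prop :=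
  ∃ f : Fin m → Fin n, StrictMono f ∧ ∀ i j, s (f i) < s (f j) ↔ t i < t j

/-- The partition `π` avoids the pattern `σ`, which is given by its canonical sequence. -/
def Avoids {n : ℕ} (π : Part n) (σ : List ℕ) : Prop :=
  ¬ ContainsSeq (canonicalSeq π) σ.get

/-- `p(n; σ)`: the number of partitions of `[n]` that avoid the pattern `σ`. -/
noncomputable def avoidCount (n : ℕ) (σ : List ℕ) : ℕ :=
  Nat.card {π : Part n // Avoids π σ}

/-- Two patterns are equivalent if, for each `n`, equally many partitions of `[n]` avoid them. -/
def PatternEquiv (σ τ : List ℕ) : Prop :=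
  ∀ n : ℕ, avoidCount n σ = avoidCount n τ

/-- The constant sequence `k ^ d` of length `d`. -/
abbrev rep (k d : ℕ) : List ℕ := List.replicate d k

end SetPartition

/-! Canonical sequences are the restricted growth functions, so in front of any letter every smaller
letter comes for free. Hence the prefix 123 of a pattern 123·T costs almost nothing. If T repeats 2
= k, the letter 3 may be taken to be k + 1, and T has to occur after some k + 1, with any s < k as
its 1 and any r > k + 1 as its 4. If T repeats 3 = k, the letter 2 may be taken to be k - 1, and T
has to occur after some k, with any s > k as its 4 and any r < k - 1 as its 1. In both cases
containment splits into levels k, and at each level the claim compares k^p r s k^q with k^p r k^q s,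
or the mirror images of these shapes.

For one level, take the part of the word after the first k + 1 (resp. k) and locate greedily the
first admissible r preceded by k^p. The rest Q contains s k^q or k^q s, and these must be exchanged.
Letters on r's side of k are run letters, those on s's side are side letters. Shrink each maximal
run in Q to a placeholder, write the resulting skeleton as E M F with M reaching from the first to
the last side letter, pass to F^rev M E^rev, and put the runs back in their old order. This is an
involution. The skeleton E M F contains s k^q iff M F has at least q letters k, and its image
contains k^q s iff F^rev M has at least q; these counts agree (`exists_sublist_swapEnds`).

The map keeps the order of the run letters and that of the side letters, hence the growth condition
(`IsRGF.of_rearrangement`). It also preserves containment at every other level j. Up to a leading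
letter that can be matched in the untouched prefix, all letters of such a pattern but one lie
strictly on one side of k, and the remaining letter is constrained only by an inequality
(`Step.exists_sublist_run`, `Step.exists_sublist_side`). So the forbidden shape can be changed one
level at a time (`card_levels_eq`). -/

namespace SetPartition

open scoped List

/-! ### Decomposition of a word into its skeleton and its runs. -/

section Runs

variable {α : Type*}

/-- Prepend `none`, unless the list already starts with it. -/
def consNone : List (Option α) → List (Option α)
  | none :: t => none :: t
  | t => none :: t

@[simp] theorem consNone_nil : consNone ([] : List (Option α)) = [none] := rfl
@[simp] theorem consNone_none (t : List (Option α)) : consNone (none :: t) = none :: t := rfl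
@[simp] theorem consNone_some (x : α) (t : List (Option α)) :
    consNone (some x :: t) = none :: some x :: t := rfl

theorem consNone_eq (t : List (Option α)) : ∃ t', consNone t = none :: t' := by
  rcases t with _ | ⟨_ | x, t⟩ <;> simp

/-- Replace every maximal run of letters that violate `p` by a single `none`. -/
def collapse (p : α → Prop) [DecidablePred p] : List α → List (Option α)
  | [] => []
  | x :: l => if p x then some x :: collapse p l else consNone (collapse p l)

/-- The maximal runs of letters that satisfy `p`. -/
def runs (p : α → Prop) [DecidablePred p] : List α → List (List α)
  | [] => []
  | [x] => if p x then [[x]] else []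
  | x :: y :: l =>
    if p x then
      if p y then
        match runs p (y :: l) with
        | [] => [[x]]
        | c :: C => (x :: c) :: C
      else [x] :: runs p (y :: l)
    else runs p (y :: l)

/-- Replace the occurrences of `none`, in order, by the given lists. -/
def fill : List (Option α) → List (List α) → List α
  | [], _ => []
  | some x :: K, C => x :: fill K C
  | none :: K, [] => fill K []
  | none :: K, c :: C => c ++ fill K C

/-- The skeleton `K` and the list of runs `C` come from a common word. -/
inductive Fits (p : α → Prop) : List (Option α) → List (List α) → Prop
  | nil : Fits p [] []
  | letter {x K C} : ¬ p x → Fits p K C → Fits p (some x :: K) C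
  | gap {c K C} : c ≠ [] → (∀ x ∈ c, p x) → K.head? ≠ some none → Fits p K C →
      Fits p (none :: K) (c :: C)

variable (p : α → Prop) [DecidablePred p]

@[simp] theorem collapse_nil : collapse p [] = [] := rfl

variable {p}

theorem collapse_cons_pos {x : α} (h : p x) (l : List α) :
    collapse p (x :: l) = some x :: collapse p l := by simp [collapse, h]

theorem collapse_cons_neg {x : α} (h : ¬ p x) (l : List α) :
    collapse p (x :: l) = consNone (collapse p l) := by simp [collapse, h]

theorem runs_cons_neg {x : α} (h : ¬ p x) (l : List α) : runs p (x :: l) = runs p l := by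
  rcases l with _ | ⟨y, l⟩ <;> simp [runs, h]

theorem runs_cons_pos {x : α} (h : p x) {l : List α} (hl : ∀ y ∈ l.head?, ¬ p y) :
    runs p (x :: l) = [x] :: runs p l := by
  rcases l with _ | ⟨y, l⟩
  · simp [runs, h]
  · have : ¬ p y := hl y (by simp)
    simp [runs, h, this]

theorem runs_cons_cons {x y : α} (hx : p x) (hy : p y) {l c : List α} {C : List (List α)}
    (h : runs p (y :: l) = c :: C) : runs p (x :: y :: l) = (x :: c) :: C := by
  rw [runs]; simp [hx, hy, h]

theorem collapse_append_run {c l : List α} (hc : c ≠ []) (hp : ∀ x ∈ c, p x)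
    (hl : ∀ y ∈ l.head?, ¬ p y) :
    collapse (fun x => ¬ p x) (c ++ l) = none :: collapse (fun x => ¬ p x) l ∧
      runs p (c ++ l) = c :: runs p l := by
  induction c with
  | nil => exact absurd rfl hc
  | cons x c ih =>
    have hx : p x := hp x (by simp)
    rcases c with _ | ⟨y, c⟩
    · constructor
      · rw [List.singleton_append, collapse_cons_neg (by simpa using hx)]
        rcases l with _ | ⟨z, l⟩
        · rfl
        · have : ¬ p z := hl z (by simp)
          rw [collapse_cons_pos (p := fun x => ¬ p x) this]; rfl
      · rw [List.singleton_append, runs_cons_pos hx hl]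
    · have hy : p y := hp y (by simp)
      obtain ⟨h1, h2⟩ := ih (by simp) (fun z hz => hp z (by simp [hz]))
      constructor
      · rw [List.cons_append, collapse_cons_neg (by simpa using hx), h1]; rfl
      · exact runs_cons_cons hx hy h2

omit [DecidablePred p] in
theorem Fits.head_fill {K : List (Option α)} {C : List (List α)} (h : Fits p K C)
    (hK : K.head? ≠ some none) : ∀ y ∈ (fill K C).head?, ¬ p y := by
  cases h with
  | nil => simp [fill]
  | letter hx _ => simpa [fill] using hx
  | gap => simp at hK

/-- Together with `fill_collapse` and `fits_collapse` this makes words correspond bijectively to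
fitting pairs of a skeleton and a list of runs. -/
theorem Fits.collapse_fill {K : List (Option α)} {C : List (List α)} (h : Fits p K C) :
    collapse (fun x => ¬ p x) (fill K C) = K ∧ runs p (fill K C) = C := by
  induction h with
  | nil => simp [fill, runs]
  | letter hx _ ih =>
    rw [fill, collapse_cons_pos (p := fun x => ¬ p x) hx, runs_cons_neg hx, ih.1, ih.2]; simp
  | gap hc hp hK h ih =>
    rw [fill]
    have := collapse_append_run hc hp (h.head_fill hK)
    rw [this.1, this.2, ih.1, ih.2]; simp

theorem head?_collapse (l : List α) :
    (collapse p l).head? = l.head?.map (fun x => if p x then some x else none) := by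
  rcases l with _ | ⟨x, l⟩
  · rfl
  · by_cases h : p x
    · simp [collapse_cons_pos h, h]
    · obtain ⟨t, ht⟩ := consNone_eq (collapse p l)
      simp [collapse_cons_neg h, h, ht]

theorem collapse_eq_nil {l : List α} : collapse p l = [] ↔ l = [] := by
  have := head?_collapse (p := p) l
  constructor
  · intro h; rw [h] at this; rcases l with _ | ⟨x, l⟩
    · rfl
    · simp at this
  · rintro rfl; rfl

theorem getLast?_collapse (l : List α) :
    (collapse p l).getLast? = l.getLast?.map (fun x => if p x then some x else none) := by
  induction l with
  | nil => rfl
  | cons x l ih =>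
    rcases l with _ | ⟨y, l⟩
    · by_cases h : p x <;> simp [collapse, h]
    · rw [List.getLast?_cons_cons, ← ih, collapse]
      have hne : collapse p (y :: l) ≠ [] := by rw [Ne, collapse_eq_nil]; simp
      generalize collapse p (y :: l) = t at *
      rcases t with _ | ⟨_ | z, t⟩
      · simp at hne
      all_goals
        by_cases h : p x
        · rw [if_pos h, List.getLast?_cons_cons]
        · rw [if_neg h]
          first
          | rw [consNone_none]
          | rw [consNone_some, List.getLast?_cons_cons]

theorem fits_collapse (l : List α) : Fits p (collapse (fun x => ¬ p x) l) (runs p l) := by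
  induction l with
  | nil => exact Fits.nil
  | cons x l ih =>
    by_cases h : p x
    · rw [collapse_cons_neg (by simpa using h)]
      rcases l with _ | ⟨y, l⟩
      · simp only [runs, h, collapse_nil, consNone_nil, if_true]
        exact Fits.gap (by simp) (by simpa using h) (by simp) Fits.nil
      · by_cases hy : p y
        · rw [collapse_cons_neg (by simpa using hy)] at ih ⊢
          obtain ⟨t, ht⟩ := consNone_eq (collapse (fun x => ¬ p x) l)
          rw [ht] at ih ⊢
          generalize hC : runs p (y :: l) = C at ih
          cases ih with
          | gap hc hp hK hf =>
            rw [runs_cons_cons h hy hC]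
            exact Fits.gap (by simp) (by simpa [h] using hp) hK hf
        · rw [runs_cons_pos h (by simpa using hy)]
          rw [collapse_cons_pos (p := fun x => ¬ p x) hy] at ih ⊢
          exact Fits.gap (by simp) (by simpa using h) (by simp) ih
    · rw [collapse_cons_pos (p := fun x => ¬ p x) h, runs_cons_neg h]
      exact Fits.letter h ih

theorem fill_collapse (l : List α) : fill (collapse (fun x => ¬ p x) l) (runs p l) = l := by
  induction l with
  | nil => rfl
  | cons x l ih =>
    by_cases h : p x
    · rw [collapse_cons_neg (by simpa using h)]
      rcases l with _ | ⟨y, l⟩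
      · simp [runs, h, fill]
      · by_cases hy : p y
        · have hf := fits_collapse (p := p) (y :: l)
          rw [collapse_cons_neg (by simpa using hy)] at ih hf ⊢
          obtain ⟨t, ht⟩ := consNone_eq (collapse (fun x => ¬ p x) l)
          rw [ht] at ih hf ⊢
          generalize hC : runs p (y :: l) = C at ih hf
          cases hf with
          | gap hc hp hK hf =>
            rw [runs_cons_cons h hy hC]
            simp only [fill] at ih
            simp [fill, ih]
        · rw [runs_cons_pos h (by simpa using hy)]
          rw [collapse_cons_pos (p := fun x => ¬ p x) hy] at ih ⊢
          simp only [consNone_some, fill] at ih ⊢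
          rw [ih]; rfl
    · rw [collapse_cons_pos (p := fun x => ¬ p x) h, runs_cons_neg h, fill, ih]

theorem reduceOption_consNone (t : List (Option α)) :
    (consNone t).reduceOption = t.reduceOption := by
  rcases t with _ | ⟨_ | x, t⟩ <;> simp

theorem reduceOption_collapse (l : List α) : (collapse p l).reduceOption = l.filter p := by
  induction l with
  | nil => rfl
  | cons x l ih =>
    by_cases h : p x
    · simp [collapse_cons_pos h, h, ih]
    · simp [collapse_cons_neg h, h, ih, reduceOption_consNone]

-- In this form only the condition on neighbouring placeholders depends on the order of the
-- skeleton, so a rearrangement of the skeleton fits as soon as it keeps placeholders apart.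
omit [DecidablePred p] in
theorem fits_iff {K : List (Option α)} {C : List (List α)} :
    Fits p K C ↔ K.IsChain (fun a b => a.isSome ∨ b.isSome) ∧ (∀ x, some x ∈ K → ¬ p x) ∧
      K.countP Option.isNone = C.length ∧ ∀ c ∈ C, c ≠ [] ∧ ∀ x ∈ c, p x := by
  constructor
  · intro h
    induction h with
    | nil => simp
    | @letter x K C hx h ih =>
      obtain ⟨h1, h2, h3, h4⟩ := ih
      refine ⟨?_, ?_, by simpa using h3, h4⟩
      · rw [List.isChain_cons]; exact ⟨by simp, h1⟩
      · intro y hy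
        rcases List.mem_cons.1 hy with e | e
        · cases e; exact hx
        · exact h2 y e
    | @gap c K C hc hp hK h ih =>
      obtain ⟨h1, h2, h3, h4⟩ := ih
      refine ⟨?_, ?_, by simpa using h3, ?_⟩
      · rw [List.isChain_cons]
        refine ⟨?_, h1⟩
        rintro (_ | y) hy
        · exact absurd hy hK
        · simp
      · intro y hy
        simpa using h2 y (by simpa using hy)
      · intro c' hc'
        rcases List.mem_cons.1 hc' with e | e
        · cases e; exact ⟨hc, hp⟩
        · exact h4 _ e
  · rintro ⟨h1, h2, h3, h4⟩
    induction K generalizing C with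
    | nil =>
      have : C = [] := by simpa [eq_comm] using h3
      subst this; exact Fits.nil
    | cons o K ih =>
      rw [List.isChain_cons] at h1
      rcases o with _ | x
      · rcases C with _ | ⟨c, C⟩
        · simp at h3
        · obtain ⟨hc, hp⟩ := h4 c (by simp)
          refine Fits.gap hc hp ?_ (ih h1.2 (fun x hx => h2 x (by simp [hx])) (by simpa using h3)
            (fun c' hc' => h4 c' (by simp [hc'])))
          intro hK
          simpa using h1.1 none hK
      · exact Fits.letter (h2 x (by simp)) (ih h1.2 (fun x hx => h2 x (by simp [hx]))
          (by simpa using h3) h4)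

/-- The lists of `C`, separated by single occurrences of `none`. -/
def joinNone : List (List α) → List (Option α)
  | [] => []
  | [c] => c.map some
  | c :: C => c.map some ++ none :: joinNone C

theorem collapse_run_append {c : List α} (hp : ∀ x ∈ c, p x) (l : List α) :
    collapse p (c ++ l) = c.map some ++ collapse p l := by
  induction c with
  | nil => rfl
  | cons x c ih =>
    rw [List.cons_append, collapse_cons_pos (hp x (by simp)), ih (fun y hy => hp y (by simp [hy]))]
    rfl

/-- Between two consecutive runs there is always at least one other letter, so shrinking those other
letters leaves a word that depends only on the runs and on the two ends. Hence the letters between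
runs may be redistributed without changing it. -/
theorem Fits.collapse_fill' {K : List (Option α)} {C : List (List α)} (h : Fits p K C)
    (hlast : K.getLast? = some none) :
    (K.head? = some none → collapse p (fill K C) = joinNone C) ∧
      (K.head? ≠ some none → collapse p (fill K C) = none :: joinNone C) := by
  induction h with
  | nil => simp at hlast
  | @letter x K C hx h ih =>
    rcases K with _ | ⟨o, K⟩
    · simp at hlast
    · rw [List.getLast?_cons_cons] at hlast
      rw [fill, collapse_cons_neg hx]
      refine ⟨by simp, fun _ => ?_⟩
      rcases o with _ | y
      · rw [(ih hlast).1 rfl]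
        cases h with
        | @gap c _ C hc hp hK h =>
          rcases c with _ | ⟨z, c⟩
          · exact absurd rfl hc
          · rcases C with _ | ⟨d, C⟩ <;> simp [joinNone]
      · rw [(ih hlast).2 (by simp)]; simp
  | @gap c K C hc hp hK h ih =>
    rw [fill, collapse_run_append hp]
    refine ⟨fun _ => ?_, by simp⟩
    rcases K with _ | ⟨o, K⟩
    · cases h; simp [fill, joinNone]
    · rw [List.getLast?_cons_cons] at hlast
      rw [(ih hlast).2 hK]
      rcases C with _ | ⟨d, C⟩
      · rw [fits_iff] at h
        have := h.2.2.1
        have hm := List.mem_of_getLast? hlast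
        rw [List.length_nil, List.countP_eq_zero] at this
        simpa using this _ hm
      · simp [joinNone]

theorem sublist_iff_sublist_filter {u : List α} (hu : ∀ x ∈ u, p x) {l : List α} :
    u <+ l ↔ u <+ l.filter p := by
  constructor
  · intro h
    have := h.filter p
    rwa [List.filter_eq_self.2 (by simpa using hu)] at this
  · exact fun h => h.trans List.filter_sublist

theorem some_sublist_consNone {a : α} {s t : List (Option α)} :
    some a :: s <+ consNone t ↔ some a :: s <+ t := by
  have h : ∀ t : List (Option α), some a :: s <+ none :: t ↔ some a :: s <+ t := fun t =>
    ⟨fun h => by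
      rcases List.sublist_cons_iff.1 h with h | ⟨r, hr, _⟩
      · exact h
      · simp at hr, fun h => h.cons _⟩
  rcases t with _ | ⟨_ | y, t⟩
  · rw [consNone_nil, h]
  · rfl
  · rw [consNone_some, h]

theorem sublist_iff_collapse {u : List α} (hu : ∀ x ∈ u, p x) {l : List α} :
    u <+ l ↔ u.map some <+ collapse p l := by
  rw [sublist_iff_sublist_filter hu, ← reduceOption_collapse]
  generalize collapse p l = t
  induction t generalizing u with
  | nil => simp
  | cons o t ih =>
    rcases u with _ | ⟨a, u⟩
    · simp
    have hu' : ∀ x ∈ u, p x := fun x hx => hu x (by simp [hx])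
    rcases o with _ | y
    · rw [List.reduceOption_cons_of_none, ih hu]
      constructor
      · exact fun h => h.cons _
      · intro h
        rcases List.sublist_cons_iff.1 h with h | ⟨r, hr, _⟩
        · exact h
        · simp at hr
    · rw [List.reduceOption_cons_of_some, List.sublist_cons_iff, List.sublist_cons_iff, ih hu]
      refine or_congr Iff.rfl ?_
      constructor
      · rintro ⟨r, hr, h⟩
        simp only [List.cons.injEq] at hr
        obtain ⟨rfl, rfl⟩ := hr
        exact ⟨u.map some, by simp, (ih hu').1 h⟩
      · rintro ⟨r, hr, h⟩
        simp only [List.map_cons, List.cons.injEq, Option.some.injEq] at hr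
        obtain ⟨rfl, rfl⟩ := hr
        exact ⟨u, rfl, (ih hu').2 h⟩

/-- When a single letter of the pattern violates `p` and its value is free, only the positions of
the maximal violating blocks matter, and these are what `collapse` records. -/
theorem exists_sublist_iff_collapse {u v : List α} (hu : ∀ x ∈ u, p x) (hv : ∀ x ∈ v, p x)
    {l : List α} :
    (∃ x, ¬ p x ∧ u ++ x :: v <+ l) ↔ u.map some ++ none :: v.map some <+ collapse p l := by
  induction l generalizing u with
  | nil => simp
  | cons x l ih =>
    by_cases h : p x
    · rw [collapse_cons_pos h, List.sublist_cons_iff, ← ih hu]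
      rcases u with _ | ⟨a, u⟩
      · constructor
        · rintro ⟨y, hy, hs⟩
          refine .inl ⟨y, hy, ?_⟩
          rcases List.sublist_cons_iff.1 hs with hs | ⟨r, hr, _⟩
          · exact hs
          · simp only [List.nil_append, List.cons.injEq] at hr
            exact absurd (hr.1 ▸ h) hy
        · rintro (⟨y, hy, hs⟩ | ⟨r, hr, _⟩)
          · exact ⟨y, hy, hs.cons _⟩
          · simp at hr
      · have hu' : ∀ x ∈ u, p x := fun x hx => hu x (by simp [hx])
        constructor
        · rintro ⟨y, hy, hs⟩
          rcases List.sublist_cons_iff.1 hs with hs | ⟨r, hr, hs⟩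
          · exact .inl ⟨y, hy, hs⟩
          · simp only [List.cons_append, List.cons.injEq] at hr
            obtain ⟨rfl, rfl⟩ := hr
            exact .inr ⟨_, rfl, (ih hu').1 ⟨y, hy, hs⟩⟩
        · rintro (⟨y, hy, hs⟩ | ⟨r, hr, hs⟩)
          · exact ⟨y, hy, hs.cons _⟩
          · simp only [List.map_cons, List.cons_append, List.cons.injEq, Option.some.injEq] at hr
            obtain ⟨rfl, rfl⟩ := hr
            obtain ⟨y, hy, hs⟩ := (ih hu').2 hs
            exact ⟨y, hy, hs.cons_cons _⟩
    · rw [collapse_cons_neg h]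
      rcases u with _ | ⟨a, u⟩
      · have h1 : (∃ y, ¬ p y ∧ [] ++ y :: v <+ x :: l) ↔ v <+ l := by
          constructor
          · rintro ⟨y, _, hs⟩
            exact List.Sublist.tail (by simpa using hs)
          · exact fun hs => ⟨x, h, hs.cons_cons _⟩
        have h2 : ([] : List α).map some ++ none :: v.map some <+ consNone (collapse p l) ↔
            v.map some <+ collapse p l := by
          obtain ⟨t, ht⟩ := consNone_eq (collapse p l)
          have h3 : v.map some <+ consNone (collapse p l) ↔ v.map some <+ collapse p l := by
            rcases v with _ | ⟨a, v⟩
            · simp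
            · exact some_sublist_consNone
          rw [← h3, ht, List.map_nil, List.nil_append, List.cons_sublist_cons]
          constructor
          · exact fun hs => hs.cons _
          · intro hs
            rcases v with _ | ⟨a, v⟩
            · simp
            · rcases List.sublist_cons_iff.1 hs with hs | ⟨r, hr, _⟩
              · exact hs
              · simp at hr
        rw [h1, h2, sublist_iff_collapse hv]
      · rw [List.map_cons, List.cons_append, some_sublist_consNone]
        refine Iff.trans ?_ (ih hu)
        constructor
        · rintro ⟨y, hy, hs⟩
          refine ⟨y, hy, ?_⟩
          rcases List.sublist_cons_iff.1 hs with hs | ⟨r, hr, _⟩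
          · exact hs
          · simp only [List.cons_append, List.cons.injEq] at hr
            exact absurd (hr.1 ▸ hu a (by simp)) h
        · rintro ⟨y, hy, hs⟩
          exact ⟨y, hy, hs.cons _⟩

end Runs

/-! ### Exchanging and reversing the two ends of a skeleton. -/

section SwapEnds

variable {β : Type*} (q : β → Prop) [DecidablePred q]

/-- Write `l = E ++ M ++ F`, where `M` extends from the first to the last element that satisfies
`q`; the result is `F.reverse ++ M ++ E.reverse`. -/
def swapEnds (l : List β) : List β :=
  (l.dropWhile (fun x => ¬ q x)).reverse.takeWhile (fun x => ¬ q x) ++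
    ((l.dropWhile (fun x => ¬ q x)).reverse.dropWhile (fun x => ¬ q x)).reverse ++
    (l.takeWhile (fun x => ¬ q x)).reverse

/-- The list begins and ends with an element that satisfies `q`. -/
def Anchored (M : List β) : Prop := (∃ x ∈ M.head?, q x) ∧ ∃ x ∈ M.getLast?, q x

variable {q}

theorem swapEnds_of_forall_not {l : List β} (h : ∀ x ∈ l, ¬ q x) : swapEnds q l = l.reverse := by
  have h1 : l.dropWhile (fun x => ¬ q x) = [] := by
    rw [List.dropWhile_eq_nil_iff]; simpa using h
  have h2 : l.takeWhile (fun x => ¬ q x) = l := by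
    rw [List.takeWhile_eq_self_iff]; simpa using h
  rw [swapEnds, h1, h2]; simp

theorem swapEnds_append {E M F : List β} (hE : ∀ x ∈ E, ¬ q x) (hF : ∀ x ∈ F, ¬ q x)
    (hM : Anchored q M) : swapEnds q (E ++ M ++ F) = F.reverse ++ M ++ E.reverse := by
  have key : ∀ {A B : List β}, (∀ x ∈ A, ¬ q x) → (∃ x ∈ B.head?, q x) →
      (A ++ B).dropWhile (fun x => ¬ q x) = B ∧ (A ++ B).takeWhile (fun x => ¬ q x) = A := by
    intro A B hA ⟨x, hx, hq⟩
    rw [List.dropWhile_append_of_pos (by simpa using hA),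
      List.takeWhile_append_of_pos (by simpa using hA)]
    rcases B with _ | ⟨y, B⟩
    · simp at hx
    · obtain rfl : y = x := by simpa using hx
      simp [hq]
  obtain ⟨⟨x, hx, hxq⟩, ⟨y, hy, hyq⟩⟩ := hM
  have h1 := key (A := E) (B := M ++ F) hE ⟨x, by
    rcases M with _ | ⟨z, M⟩
    · simp at hx
    · simpa using hx, hxq⟩
  have h2 := key (A := F.reverse) (B := M.reverse) (by simpa using hF)
    ⟨y, by simpa [List.head?_reverse] using hy, hyq⟩
  rw [← List.append_assoc] at h1
  rw [swapEnds, h1.1, h1.2, List.reverse_append, h2.1, h2.2]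
  simp

variable (q) in
theorem exists_anchored (l : List β) : (∀ x ∈ l, ¬ q x) ∨ ∃ E M F, l = E ++ M ++ F ∧
    (∀ x ∈ E, ¬ q x) ∧ (∀ x ∈ F, ¬ q x) ∧ Anchored q M := by
  have key : ∀ l : List β, (∀ x ∈ l, ¬ q x) ∨ ∃ A x B, l = A ++ x :: B ∧ (∀ x ∈ A, ¬ q x) ∧ q x := by
    intro l
    induction l with
    | nil => simp
    | cons y l ih =>
      by_cases hy : q y
      · exact .inr ⟨[], y, l, rfl, by simp, hy⟩
      · rcases ih with h | ⟨A, x, B, rfl, hA, hx⟩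
        · exact .inl (by simpa [hy] using h)
        · exact .inr ⟨y :: A, x, B, rfl, by simpa [hy] using hA, hx⟩
  rcases key l with h | ⟨A, x, B, rfl, hA, hx⟩
  · exact .inl h
  · rcases key (x :: B).reverse with h | ⟨C, y, D, hD, hC, hy⟩
    · exact absurd hx (h x (by simp))
    · refine .inr ⟨A, (y :: D).reverse, C.reverse, ?_, hA, by simpa using hC, ?_, ?_⟩
      · have := congrArg List.reverse hD
        rw [List.reverse_reverse] at this
        rw [this]; simp
      · have := congrArg List.getLast? hD
        rw [List.getLast?_reverse] at this
        refine ⟨x, ?_, hx⟩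
        rw [List.head?_reverse]
        simpa using this.symm
      · exact ⟨y, by simp, hy⟩

variable (q) in
theorem swapEnds_perm (l : List β) : swapEnds q l ~ l := by
  rcases exists_anchored q l with h | ⟨E, M, F, rfl, hE, hF, hM⟩
  · rw [swapEnds_of_forall_not h]; exact List.reverse_perm l
  · rw [swapEnds_append hE hF hM]
    refine (((List.reverse_perm F).append_right M).append (List.reverse_perm E)).trans ?_
    refine List.perm_append_comm.trans ?_
    rw [List.append_assoc]
    exact List.perm_append_comm.append_left E

variable (q) in
theorem swapEnds_swapEnds (l : List β) : swapEnds q (swapEnds q l) = l := by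
  rcases exists_anchored q l with h | ⟨E, M, F, rfl, hE, hF, hM⟩
  · rw [swapEnds_of_forall_not h, swapEnds_of_forall_not (by simpa using h), List.reverse_reverse]
  · rw [swapEnds_append hE hF hM, swapEnds_append (by simpa using hF) (by simpa using hE) hM]
    simp

omit [DecidablePred q] in
/-- A list that begins and ends with elements satisfying `q` embeds into the anchored part. -/
theorem Anchored.sublist_iff {t E M F : List β} (ht : Anchored q t) (hE : ∀ x ∈ E, ¬ q x)
    (hF : ∀ x ∈ F, ¬ q x) : t <+ E ++ M ++ F ↔ t <+ M := by
  have key : ∀ {A B t : List β}, (∀ x ∈ A, ¬ q x) → (∃ x ∈ t.head?, q x) → t <+ A ++ B → t <+ B := by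
    intro A B t hA ⟨x, hx, hq⟩ h
    obtain ⟨t1, t2, rfl, h1, h2⟩ := List.sublist_append_iff.1 h
    rcases t1 with _ | ⟨y, t1⟩
    · exact h2
    · obtain rfl : y = x := by simpa using hx
      exact absurd hq (hA y (h1.subset (by simp)))
  constructor
  · intro h
    rw [List.append_assoc] at h
    have h1 := (key hE ht.1 h).reverse
    rw [List.reverse_append] at h1
    obtain ⟨x, hx, hq⟩ := ht.2
    have := key (by simpa using hF) ⟨x, by simpa [List.head?_reverse] using hx, hq⟩ h1
    simpa using this.reverse
  · intro h
    exact h.trans ((List.sublist_append_right E M).trans (List.sublist_append_left _ F))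

theorem Anchored.sublist_swapEnds_iff {t l : List β} (ht : Anchored q t) :
    t <+ swapEnds q l ↔ t <+ l := by
  rcases exists_anchored q l with h | ⟨E, M, F, rfl, hE, hF, hM⟩
  · obtain ⟨x, hx, hq⟩ := ht.1
    have hm : x ∈ t := List.mem_of_mem_head? hx
    refine iff_of_false (fun hs => ?_) (fun hs => h x (hs.subset hm) hq)
    exact h x ((swapEnds_perm q l).subset (hs.subset hm)) hq
  · rw [swapEnds_append hE hF hM, ht.sublist_iff hE hF,
      ht.sublist_iff (by simpa using hF) (by simpa using hE)]

theorem filter_swapEnds (l : List β) : (swapEnds q l).filter q = l.filter q := by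
  rcases exists_anchored q l with h | ⟨E, M, F, rfl, hE, hF, hM⟩
  · rw [swapEnds_of_forall_not h, List.filter_eq_nil_iff.2 (by simpa using h),
      List.filter_eq_nil_iff.2 (by simpa using h)]
  · rw [swapEnds_append hE hF hM]
    have hE' : E.filter q = [] := List.filter_eq_nil_iff.2 (by simpa using hE)
    have hF' : F.filter q = [] := List.filter_eq_nil_iff.2 (by simpa using hF)
    simp [List.filter_reverse, hE', hF']

theorem head?_swapEnds {l : List β} {o : β} (ho : ¬ q o) (h1 : l.head? = some o)
    (h2 : l.getLast? = some o) :
    (swapEnds q l).head? = some o ∧ (swapEnds q l).getLast? = some o := by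
  rcases exists_anchored q l with h | ⟨E, M, F, rfl, hE, hF, hM⟩
  · rw [swapEnds_of_forall_not h]; simp [h1, h2]
  · rw [swapEnds_append hE hF hM]
    obtain ⟨⟨x, hx, hxq⟩, ⟨y, hy, hyq⟩⟩ := hM
    have e1 : E.head? = some o := by
      rcases E with _ | ⟨z, E⟩
      · rcases M with _ | ⟨z, M⟩
        · simp at hx
        · simp only [List.nil_append, List.cons_append, List.head?_cons, Option.some.injEq] at h1
          simp only [List.head?_cons, Option.mem_def, Option.some.injEq] at hx
          exact absurd (h1 ▸ hx ▸ hxq) ho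
      · simpa using h1
    have e2 : F.getLast? = some o := by
      rcases List.eq_nil_or_concat F with rfl | ⟨F, z, rfl⟩
      · rw [List.append_nil, List.getLast?_append, hy] at h2
        simp only [Option.some_or, Option.some.injEq] at h2
        exact absurd (h2 ▸ hyq) ho
      · simpa using h2
    constructor
    · rw [List.append_assoc, List.head?_append, List.head?_reverse, e2]; simp
    · rw [List.getLast?_append, List.getLast?_reverse, e1]; simp

-- The best choice of `s` is the first element satisfying `q`, which is the head of `M`; it is not
-- itself an `o`, so all copies of `o` in `M ++ F` remain available.
omit [DecidablePred q] in
theorem exists_cons_replicate_sublist {o : β} (ho : ¬ q o) {E M F : List β}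
    (hE : ∀ x ∈ E, ¬ q x) (hM : ∃ x ∈ M.head?, q x) (n : ℕ) :
    (∃ s, q s ∧ s :: List.replicate n o <+ E ++ M ++ F) ↔ List.replicate n o <+ M ++ F := by
  constructor
  · rintro ⟨s, hs, h⟩
    rw [List.append_assoc] at h
    obtain ⟨t1, t2, ht, h1, h2⟩ := List.sublist_append_iff.1 h
    rcases t1 with _ | ⟨y, t1⟩
    · rw [List.nil_append] at ht
      rw [← ht] at h2
      exact (List.sublist_cons_self _ _).trans h2
    · simp only [List.cons_append, List.cons.injEq] at ht
      exact absurd hs (hE s (h1.subset (by simp [ht.1])))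
  · intro h
    obtain ⟨s, hs, hq⟩ := hM
    rcases M with _ | ⟨s', M⟩
    · simp at hs
    · obtain rfl : s' = s := by simpa using hs
      refine ⟨s', hq, ?_⟩
      rw [List.append_assoc]
      refine List.Sublist.trans ?_ (List.sublist_append_right E _)
      rw [List.cons_append, List.cons_sublist_cons]
      rw [List.cons_append] at h
      rcases List.sublist_cons_iff.1 h with h | ⟨r, hr, _⟩
      · exact h
      · have hm : s' ∈ List.replicate n o := by rw [hr]; simp
        exact absurd (List.eq_of_mem_replicate hm ▸ hq) ho

/-- Both sides say that `M` and `F` together have at least `n` copies of `o`: on the right they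
follow the first element satisfying `q`, and on the left they precede the last one. -/
theorem exists_sublist_swapEnds {o : β} (ho : ¬ q o) (l : List β) (n : ℕ) :
    (∃ s, q s ∧ List.replicate n o ++ [s] <+ swapEnds q l) ↔
      ∃ s, q s ∧ s :: List.replicate n o <+ l := by
  classical
  rcases exists_anchored q l with h | ⟨E, M, F, rfl, hE, hF, hM⟩
  · refine iff_of_false ?_ ?_
    · rintro ⟨s, hs, h'⟩
      exact h s ((swapEnds_perm q l).subset (h'.subset (by simp))) hs
    · rintro ⟨s, hs, h'⟩
      exact h s (h'.subset (by simp)) hs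
  · rw [swapEnds_append hE hF hM, exists_cons_replicate_sublist ho hE hM.1]
    have h := exists_cons_replicate_sublist ho (E := E) (M := M.reverse) (F := F) hE
      (by simpa [List.head?_reverse] using hM.2) n
    have e : (F.reverse ++ M ++ E.reverse).reverse = E ++ M.reverse ++ F := by simp
    have h' : (∃ s, q s ∧ List.replicate n o ++ [s] <+ F.reverse ++ M ++ E.reverse) ↔
        ∃ s, q s ∧ s :: List.replicate n o <+ E ++ M.reverse ++ F := by
      refine exists_congr fun s => and_congr_right fun _ => ?_
      rw [← e, ← List.reverse_sublist]
      simp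
    rw [h', h, List.replicate_sublist_iff, List.replicate_sublist_iff, List.count_append,
      List.count_append, List.count_reverse]

end SwapEnds

/-- Reversal creates no new neighbours, and at both new junctions the neighbour from `M` satisfies
`q`, so it is not a placeholder. -/
theorem isChain_swapEnds {α : Type*} {q : Option α → Prop} [DecidablePred q] (hq : ¬ q none)
    {K : List (Option α)} (h : K.IsChain (fun a b => a.isSome ∨ b.isSome)) :
    (swapEnds q K).IsChain (fun a b => a.isSome ∨ b.isSome) := by
  have hrev : ∀ {L : List (Option α)}, L.IsChain (fun a b => a.isSome ∨ b.isSome) →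
      L.reverse.IsChain (fun a b => a.isSome ∨ b.isSome) := by
    intro L hL
    rw [List.isChain_reverse]
    exact hL.imp (fun a b h => h.symm)
  have hsome : ∀ o, q o → o.isSome := by
    rintro (_ | x) ho
    · exact absurd ho hq
    · rfl
  rcases exists_anchored q K with h' | ⟨E, M, F, rfl, hE, hF, hM⟩
  · rw [swapEnds_of_forall_not h']; exact hrev h
  · rw [swapEnds_append hE hF hM]
    obtain ⟨⟨x, hx, hxq⟩, ⟨y, hy, hyq⟩⟩ := hM
    rw [List.isChain_append, List.isChain_append] at h ⊢
    obtain ⟨⟨hE', hM', -⟩, hF', -⟩ := h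
    refine ⟨⟨hrev hF', hM', ?_⟩, hrev hE', ?_⟩
    · intro a _ b hb
      rw [hx] at hb
      simp only [Option.mem_def, Option.some.injEq] at hb
      exact .inr (hb ▸ hsome _ hxq)
    · intro a ha b _
      rw [List.getLast?_append, hy] at ha
      simp only [Option.some_or, Option.mem_def, Option.some.injEq] at ha
      exact .inl (ha ▸ hsome _ hyq)

theorem Fits.swapEnds {α : Type*} {p : α → Prop} {q : Option α → Prop} [DecidablePred q]
    (hq : ¬ q none) {K : List (Option α)} {C : List (List α)} (h : Fits p K C) :
    Fits p (swapEnds q K) C := by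
  rw [fits_iff] at h ⊢
  obtain ⟨h1, h2, h3, h4⟩ := h
  refine ⟨isChain_swapEnds hq h1, fun x hx => h2 x ((swapEnds_perm q K).subset hx), ?_, h4⟩
  rw [(swapEnds_perm q K).countP_eq, h3]

/-! ### The flip of a word and what it preserves. -/

section Flip

variable (R : ℕ → Prop) [DecidablePred R] (b : ℕ)

/-- The letter of a skeleton is neither a placeholder nor `b`. -/
def IsSide : Option ℕ → Prop
  | none => False
  | some x => ¬ R x ∧ x ≠ b

instance : DecidablePred (IsSide R b)
  | none => inferInstanceAs (Decidable False)
  | some x => inferInstanceAs (Decidable (¬ R x ∧ x ≠ b))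

/-- Apply `swapEnds` to the skeleton of a word, keeping the sequence of its runs. -/
def flipWord (W : List ℕ) : List ℕ :=
  fill (swapEnds (IsSide R b) (collapse (fun x => ¬ R x) W)) (runs R W)

/-- The words `Q` and `Q'` are indistinguishable for the patterns of all values but `b`. -/
structure Rel (Q Q' : List ℕ) : Prop where
  perm : Q ~ Q'
  filter_side : Q.filter (fun x => ¬ R x ∧ x ≠ b) = Q'.filter (fun x => ¬ R x ∧ x ≠ b)
  filter_run : Q.filter R = Q'.filter R
  cross_iff : ∀ u v : List ℕ, (∀ x ∈ u, R x) → (∀ x ∈ v, R x) →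
    ((∃ y, ¬ R y ∧ u ++ y :: v <+ Q) ↔ ∃ y, ¬ R y ∧ u ++ y :: v <+ Q')
  test_iff : ∀ u v : List ℕ, u ≠ [] → v ≠ [] → (∀ x ∈ u, ¬ R x ∧ x ≠ b) →
    (∀ x ∈ v, ¬ R x ∧ x ≠ b) →
    ((∃ y, R y ∧ u ++ y :: v <+ Q) ↔ ∃ y, R y ∧ u ++ y :: v <+ Q')
  test_iff' : ∀ u v : List ℕ, u ≠ [] → v ≠ [] → (∀ x ∈ u, ¬ R x ∧ x ≠ b) →
    (∀ x ∈ v, ¬ R x ∧ x ≠ b) → (u ++ b :: v <+ Q ↔ u ++ b :: v <+ Q')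

variable {R b}

theorem collapse_flipWord (W : List ℕ) : collapse (fun x => ¬ R x) (flipWord R b W) =
    swapEnds (IsSide R b) (collapse (fun x => ¬ R x) W) :=
  ((fits_collapse (p := R) W).swapEnds (q := IsSide R b) (by simp [IsSide])).collapse_fill.1

theorem runs_flipWord (W : List ℕ) : runs R (flipWord R b W) = runs R W :=
  ((fits_collapse (p := R) W).swapEnds (q := IsSide R b) (by simp [IsSide])).collapse_fill.2

variable (R b) in
theorem flipWord_flipWord (W : List ℕ) : flipWord R b (flipWord R b W) = W := by
  rw [flipWord, collapse_flipWord, runs_flipWord, swapEnds_swapEnds, fill_collapse]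

theorem filter_isSide_reduceOption (K : List (Option ℕ)) :
    K.reduceOption.filter (fun x => ¬ R x ∧ x ≠ b) = (K.filter (IsSide R b)).reduceOption := by
  induction K with
  | nil => rfl
  | cons o K ih =>
    rcases o with _ | x
    · have h : ¬ IsSide R b none := id
      rw [List.reduceOption_cons_of_none, ih, List.filter_cons]
      simp [h]
    · have e : IsSide R b (some x) ↔ (¬ R x ∧ x ≠ b) := Iff.rfl
      rw [List.reduceOption_cons_of_some, List.filter_cons, List.filter_cons, ih]
      by_cases h : ¬ R x ∧ x ≠ b
      · rw [if_pos (decide_eq_true h), if_pos (decide_eq_true (e.2 h)),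
          List.reduceOption_cons_of_some]
      · rw [if_neg (by simpa using h), if_neg (by simpa [e] using h)]

theorem filter_side (W : List ℕ) : W.filter (fun x => ¬ R x ∧ x ≠ b) =
    ((collapse (fun x => ¬ R x) W).filter (IsSide R b)).reduceOption := by
  rw [← filter_isSide_reduceOption, reduceOption_collapse, List.filter_filter]
  congr 1
  funext x
  by_cases h : R x <;> simp [h]

omit [DecidablePred R] in
theorem anchored_test {o : Option ℕ} {u v : List ℕ} (hu : u ≠ []) (hv : v ≠ [])
    (hu' : ∀ x ∈ u, ¬ R x ∧ x ≠ b) (hv' : ∀ x ∈ v, ¬ R x ∧ x ≠ b) :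
    Anchored (IsSide R b) (u.map some ++ o :: v.map some) := by
  constructor
  · rcases u with _ | ⟨x, u⟩
    · exact absurd rfl hu
    · exact ⟨some x, by simp, hu' x (by simp)⟩
  · rcases List.eq_nil_or_concat v with rfl | ⟨v, x, rfl⟩
    · exact absurd rfl hv
    · exact ⟨some x, by simp [List.getLast?_append, List.getLast?_cons], hv' x (by simp)⟩

/-- A word that begins and ends with a run has a skeleton with placeholders at both ends, and
`swapEnds` keeps them there. Such a word collapses to its runs joined by `none`, and the flip does
not change the runs. -/
theorem collapse_flipWord_run {W : List ℕ} (h1 : ∃ x ∈ W.head?, R x)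
    (h2 : ∃ x ∈ W.getLast?, R x) : collapse R W = collapse R (flipWord R b W) := by
  have hf := fits_collapse (p := R) W
  have hf' := hf.swapEnds (q := IsSide R b) (by simp [IsSide])
  have k1 : (collapse (fun x => ¬ R x) W).head? = some none := by
    obtain ⟨x, hx, hr⟩ := h1
    rw [head?_collapse, hx]; simp [hr]
  have k2 : (collapse (fun x => ¬ R x) W).getLast? = some none := by
    obtain ⟨x, hx, hr⟩ := h2
    rw [getLast?_collapse, hx]; simp [hr]
  have k3 := head?_swapEnds (q := IsSide R b) (by simp [IsSide]) k1 k2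
  have e1 := (hf.collapse_fill' k2).1 k1
  rw [fill_collapse] at e1
  rw [e1, flipWord, (hf'.collapse_fill' k3.2).1 k3.1]

/-- Statements about runs follow from the equality of the collapsed words. Statements about side
letters hold because a pattern that begins and ends with side letters embeds into `M` alone, which
the flip leaves in place. -/
theorem rel_flipWord (hb : ¬ R b) {W : List ℕ} (h1 : ∃ x ∈ W.head?, R x)
    (h2 : ∃ x ∈ W.getLast?, R x) : Rel R b W (flipWord R b W) := by
  have hc := collapse_flipWord_run (b := b) h1 h2
  have hrun := congrArg List.reduceOption hc
  rw [reduceOption_collapse, reduceOption_collapse] at hrun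
  refine ⟨?_, ?_, hrun, ?_, ?_, ?_⟩
  · refine (List.filter_append_perm R W).symm.trans
      (List.Perm.trans ?_ (List.filter_append_perm R (flipWord R b W)))
    rw [hrun]
    refine List.Perm.append_left _ ?_
    have e2 := (swapEnds_perm (IsSide R b) (collapse (fun x => ¬ R x) W)).filterMap id
    rw [← collapse_flipWord] at e2
    have e3 := reduceOption_collapse (p := fun x => ¬ R x) W
    have e4 := reduceOption_collapse (p := fun x => ¬ R x) (flipWord R b W)
    simp only [List.reduceOption] at e3 e4
    rw [e3, e4] at e2
    simpa using e2.symm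
  · rw [filter_side, filter_side, collapse_flipWord, filter_swapEnds]
  · intro u v hu hv
    rw [exists_sublist_iff_collapse hu hv, exists_sublist_iff_collapse hu hv, hc]
  · intro u v hu hv hu' hv'
    have key := fun W : List ℕ => exists_sublist_iff_collapse (p := fun x => ¬ R x) (u := u) (v := v)
      (fun x hx => (hu' x hx).1) (fun x hx => (hv' x hx).1) (l := W)
    simp only [not_not] at key
    rw [key, key, collapse_flipWord, (anchored_test hu hv hu' hv').sublist_swapEnds_iff]
  · intro u v hu hv hu' hv'
    have huv : ∀ x ∈ u ++ b :: v, ¬ R x := by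
      intro x hx
      simp only [List.mem_append, List.mem_cons] at hx
      rcases hx with h | rfl | h
      exacts [(hu' x h).1, hb, (hv' x h).1]
    rw [sublist_iff_collapse (p := fun x => ¬ R x) huv, sublist_iff_collapse (p := fun x => ¬ R x) huv,
      collapse_flipWord, List.map_append, List.map_cons,
      (anchored_test hu hv hu' hv').sublist_swapEnds_iff]

theorem exists_sublist_flipWord (hb : ¬ R b) (W : List ℕ) (n : ℕ) :
    (∃ s, (¬ R s ∧ s ≠ b) ∧ List.replicate n b ++ [s] <+ flipWord R b W) ↔
      ∃ s, (¬ R s ∧ s ≠ b) ∧ s :: List.replicate n b <+ W := by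
  have h := exists_sublist_swapEnds (q := IsSide R b) (o := some b) (by simp [IsSide])
    (collapse (fun x => ¬ R x) W) n
  have hs : ∀ (L : List ℕ), (∀ x ∈ L, ¬ R x) → ∀ W : List ℕ,
      (L <+ W ↔ L.map some <+ collapse (fun x => ¬ R x) W) :=
    fun L hL W => sublist_iff_collapse (p := fun x => ¬ R x) hL
  have key : ∀ f : Option ℕ → Prop, (∃ s, IsSide R b s ∧ f s) ↔
      ∃ s, (¬ R s ∧ s ≠ b) ∧ f (some s) := by
    intro f
    constructor
    · rintro ⟨_ | s, hs, h⟩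
      · exact hs.elim
      · exact ⟨s, hs, h⟩
    · rintro ⟨s, hs, h⟩
      exact ⟨some s, hs, h⟩
  rw [key, key, ← collapse_flipWord] at h
  refine Iff.trans (exists_congr fun s => and_congr_right fun hr => ?_)
    (h.trans (exists_congr fun s => and_congr_right fun hr => ?_))
  · rw [hs]
    · simp
    · intro x hx
      simp only [List.mem_append, List.mem_replicate, List.mem_singleton] at hx
      rcases hx with ⟨-, rfl⟩ | rfl
      exacts [hb, hr.1]
  · rw [hs]
    · simp
    · intro x hx
      simp only [List.mem_cons, List.mem_replicate] at hx
      rcases hx with rfl | ⟨-, rfl⟩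
      exacts [hr.1, hb]

end Flip

/-! ### Flipping a factor next to a run letter. -/

section Inner

variable (R : ℕ → Prop) [DecidablePred R] (b : ℕ)

/-- The effect of `flipWord` on a word, after it has been enclosed between two copies of `r`. -/
def innerFlip (r : ℕ) (Q : List ℕ) : List ℕ :=
  (flipWord R b (r :: (Q ++ [r]))).tail.dropLast

variable {R b}

/-- Equal collapsed words have equal end letters, and the end letters here satisfy `R`. So the
enclosing copies of `r` survive and can be stripped off again. -/
theorem flipWord_enclosed (hb : ¬ R b) {r : ℕ} (hr : R r) (Q : List ℕ) :
    flipWord R b (r :: (Q ++ [r])) = r :: (innerFlip R b r Q ++ [r]) := by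
  have h1 : ∃ x ∈ (r :: (Q ++ [r])).head?, R x := ⟨r, by simp, hr⟩
  have h2 : ∃ x ∈ (r :: (Q ++ [r])).getLast?, R x := ⟨r, by simp [List.getLast?_cons], hr⟩
  have hc := collapse_flipWord_run (b := b) h1 h2
  have hp := (rel_flipWord hb h1 h2).perm
  rw [innerFlip]
  generalize flipWord R b (r :: (Q ++ [r])) = W at hc hp
  rcases W with _ | ⟨x, W⟩
  · simpa using hp.length_eq
  rcases List.eq_nil_or_concat W with rfl | ⟨W, y, rfl⟩
  · simpa using hp.length_eq
  have e1 := congrArg List.head? hc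
  have e2 := congrArg List.getLast? hc
  rw [head?_collapse, head?_collapse] at e1
  rw [getLast?_collapse, getLast?_collapse] at e2
  have hx : x = r := by
    by_cases hx : R x
    · simpa [hr, hx, eq_comm] using e1
    · simp [hr, hx] at e1
  have hy : y = r := by
    by_cases hy : R y
    · simpa [hr, hy, eq_comm, List.getLast?_cons] using e2
    · simp [hr, hy, List.getLast?_cons] at e2
  simp [hx, hy]

theorem innerFlip_innerFlip (hb : ¬ R b) {r : ℕ} (hr : R r) (Q : List ℕ) :
    innerFlip R b r (innerFlip R b r Q) = Q := by
  conv_lhs => rw [innerFlip, ← flipWord_enclosed hb hr, flipWord_flipWord]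
  simp

omit [DecidablePred R] in
theorem sublist_enclosed_iff {r : ℕ} (hr : R r) {t Q : List ℕ} (h1 : ∃ x ∈ t.head?, ¬ R x)
    (h2 : ∃ x ∈ t.getLast?, ¬ R x) : t <+ r :: (Q ++ [r]) ↔ t <+ Q := by
  have h := Anchored.sublist_iff (q := fun x => ¬ R x) (t := t) (E := [r]) (M := Q) (F := [r])
    ⟨h1, h2⟩ (by simpa using hr) (by simpa using hr)
  simpa using h

theorem rel_innerFlip (hb : ¬ R b) {r : ℕ} (hr : R r) (Q : List ℕ) :
    Rel R b Q (innerFlip R b r Q) := by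
  have h := rel_flipWord hb (W := r :: (Q ++ [r])) ⟨r, by simp, hr⟩
    ⟨r, by simp [List.getLast?_cons], hr⟩
  rw [flipWord_enclosed hb hr] at h
  have henc : ∀ {u v : List ℕ} {y : ℕ} {Q : List ℕ}, u ≠ [] → v ≠ [] →
      (∀ x ∈ u, ¬ R x ∧ x ≠ b) → (∀ x ∈ v, ¬ R x ∧ x ≠ b) →
      (u ++ y :: v <+ r :: (Q ++ [r]) ↔ u ++ y :: v <+ Q) := by
    intro u v y Q hu hv hu' hv'
    refine sublist_enclosed_iff hr ?_ ?_
    · rcases u with _ | ⟨x, u⟩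
      · exact absurd rfl hu
      · exact ⟨x, by simp, (hu' x (by simp)).1⟩
    · rcases List.eq_nil_or_concat v with rfl | ⟨v, x, rfl⟩
      · exact absurd rfl hv
      · exact ⟨x, by simp [List.getLast?_append, List.getLast?_cons], (hv' x (by simp)).1⟩
  refine ⟨?_, ?_, ?_, ?_, ?_, ?_⟩
  · exact (List.perm_append_right_iff [r]).1 (List.perm_cons r |>.1 h.perm)
  · simpa [hr] using h.filter_side
  · simpa [hr] using h.filter_run
  · intro u v hu hv
    have := h.cross_iff (r :: u) (v ++ [r]) (by simpa [hr] using hu) (by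
      intro x hx
      rcases List.mem_append.1 hx with hx | hx
      · exact hv x hx
      · rw [List.mem_singleton.1 hx]; exact hr)
    have e : ∀ (y : ℕ) (Q : List ℕ), r :: u ++ y :: (v ++ [r]) <+ r :: (Q ++ [r]) ↔
        u ++ y :: v <+ Q := by
      intro y Q
      rw [List.cons_append, List.cons_sublist_cons, ← List.cons_append, ← List.append_assoc,
        List.append_sublist_append_right]
    simpa only [e] using this
  · intro u v hu hv hu' hv'
    simpa only [henc hu hv hu' hv'] using h.test_iff u v hu hv hu' hv'
  · intro u v hu hv hu' hv'
    simpa only [henc hu hv hu' hv'] using h.test_iff' u v hu hv hu' hv'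

theorem exists_sublist_innerFlip (hb : ¬ R b) {r : ℕ} (hr : R r) (Q : List ℕ) (n : ℕ) :
    (∃ s, (¬ R s ∧ s ≠ b) ∧ List.replicate n b ++ [s] <+ innerFlip R b r Q) ↔
      ∃ s, (¬ R s ∧ s ≠ b) ∧ s :: List.replicate n b <+ Q := by
  have h := exists_sublist_flipWord hb (r :: (Q ++ [r])) n
  rw [flipWord_enclosed hb hr] at h
  refine Iff.trans (exists_congr fun s => and_congr_right fun hs => ?_)
    (h.trans (exists_congr fun s => and_congr_right fun hs => ?_))
  · refine (sublist_enclosed_iff hr ?_ ⟨s, by simp, hs.1⟩).symm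
    rcases n with _ | n
    · exact ⟨s, by simp, hs.1⟩
    · exact ⟨b, by simp [List.replicate_succ], hb⟩
  · refine sublist_enclosed_iff hr ⟨s, by simp, hs.1⟩ ?_
    rcases n with _ | n
    · exact ⟨s, by simp, hs.1⟩
    · exact ⟨b, by simp [List.replicate_succ', List.getLast?_cons], hb⟩

theorem Rel.reverse {Q Q' : List ℕ} (h : Rel R b Q Q') : Rel R b Q.reverse Q'.reverse := by
  have hrev : ∀ (u v : List ℕ) (y : ℕ) (Q : List ℕ),
      u ++ y :: v <+ Q.reverse ↔ v.reverse ++ y :: u.reverse <+ Q := by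
    intro u v y Q
    rw [← List.reverse_sublist, List.reverse_reverse]
    simp
  refine ⟨?_, ?_, ?_, ?_, ?_, ?_⟩
  · exact (List.reverse_perm _).trans (h.perm.trans (List.reverse_perm _).symm)
  · rw [List.filter_reverse, List.filter_reverse, h.filter_side]
  · rw [List.filter_reverse, List.filter_reverse, h.filter_run]
  · intro u v hu hv
    simp only [hrev]
    exact h.cross_iff _ _ (by simpa using hv) (by simpa using hu)
  · intro u v hu hv hu' hv'
    simp only [hrev]
    exact h.test_iff _ _ (by simpa using hv) (by simpa using hu) (by simpa using hv')
      (by simpa using hu')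
  · intro u v hu hv hu' hv'
    simp only [hrev]
    exact h.test_iff' _ _ (by simpa using hv) (by simpa using hu) (by simpa using hv')
      (by simpa using hu')

end Inner

/-! ### The map on one level: a greedy choice of the pivot. -/

section Pivot

variable (R R' : ℕ → Prop) [DecidablePred R] [DecidablePred R'] (b : ℕ)

/-- Apply `innerFlip` to the part of the word after the first letter satisfying `R'` that is
preceded by at least `n` copies of `b`. -/
def pivotFlip : ℕ → List ℕ → List ℕ
  | _, [] => []
  | 0, x :: l => if R' x then x :: innerFlip R b x l else x :: pivotFlip 0 l
  | n + 1, x :: l => if x = b then x :: pivotFlip n l else x :: pivotFlip (n + 1) l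

/-- The words agree, or differ by related factors that are adjacent to a letter satisfying `R'`,
on the side indicated by `left`. -/
def Step (left : Prop) (l l' : List ℕ) : Prop :=
  l' = l ∨ ∃ D Q Q' Z, l = D ++ Q ++ Z ∧ l' = D ++ Q' ++ Z ∧ Rel R b Q Q' ∧
    ((∃ r D₁, left ∧ R' r ∧ D = D₁ ++ [r] ∧ Z = []) ∨
      ∃ r Z₁, ¬ left ∧ R' r ∧ D = [] ∧ Z = r :: Z₁)

variable {R R' b}

theorem pivotFlip_pivotFlip (hb : ¬ R b) (hR : ∀ x, R' x → R x) (n : ℕ) (l : List ℕ) :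
    pivotFlip R R' b n (pivotFlip R R' b n l) = l := by
  induction l generalizing n with
  | nil => cases n <;> rfl
  | cons x l ih =>
    rcases n with _ | n
    · by_cases h : R' x
      · simp [pivotFlip, h, innerFlip_innerFlip hb (hR x h)]
      · simp [pivotFlip, h, ih]
    · by_cases h : x = b <;> simp [pivotFlip, h, ih]

theorem pivotFlip_eq (hb : ¬ R b) (hR : ∀ x, R' x → R x) (n : ℕ) (l : List ℕ) :
    pivotFlip R R' b n l = l ∨ ∃ D r Q Q', R' r ∧ l = D ++ r :: Q ∧
      pivotFlip R R' b n l = D ++ r :: Q' ∧ Rel R b Q Q' := by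
  have hcons : ∀ (x : ℕ) (l l' : List ℕ), (l' = l ∨ ∃ D r Q Q', R' r ∧ l = D ++ r :: Q ∧
      l' = D ++ r :: Q' ∧ Rel R b Q Q') → (x :: l' = x :: l ∨ ∃ D r Q Q', R' r ∧
      x :: l = D ++ r :: Q ∧ x :: l' = D ++ r :: Q' ∧ Rel R b Q Q') := by
    rintro x l l' (rfl | ⟨D, r, Q, Q', hr, rfl, rfl, h⟩)
    · exact .inl rfl
    · exact .inr ⟨x :: D, r, Q, Q', hr, rfl, rfl, h⟩
  induction l generalizing n with
  | nil => cases n <;> exact .inl rfl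
  | cons x l ih =>
    rcases n with _ | n
    · by_cases h : R' x
      · exact .inr ⟨[], x, l, innerFlip R b x l, h, rfl, by simp [pivotFlip, h],
          rel_innerFlip hb (hR x h) l⟩
      · rw [pivotFlip, if_neg h]
        exact hcons _ _ _ (ih 0)
    · rw [pivotFlip]
      split_ifs
      · exact hcons _ _ _ (ih n)
      · exact hcons _ _ _ (ih (n + 1))

theorem step_pivotFlip (hb : ¬ R b) (hR : ∀ x, R' x → R x) (n : ℕ) (l : List ℕ) :
    Step R R' b True l (pivotFlip R R' b n l) := by
  rcases pivotFlip_eq hb hR n l with h | ⟨D, r, Q, Q', hr, h1, h2, h3⟩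
  · exact .inl h
  · exact .inr ⟨D ++ [r], Q, Q', [], by simp [h1], by simp [h2], h3, .inl ⟨r, D, trivial, hr, rfl, rfl⟩⟩

theorem step_reverse_pivotFlip (hb : ¬ R b) (hR : ∀ x, R' x → R x) (n : ℕ) (l : List ℕ) :
    Step R R' b False l (pivotFlip R R' b n l.reverse).reverse := by
  rcases pivotFlip_eq hb hR n l.reverse with h | ⟨D, r, Q, Q', hr, h1, h2, h3⟩
  · exact .inl (by rw [h, List.reverse_reverse])
  · refine .inr ⟨[], Q.reverse, Q'.reverse, r :: D.reverse, ?_, by simp [h2], h3.reverse,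
      .inr ⟨r, _, id, hr, rfl, rfl⟩⟩
    rw [← List.reverse_reverse l, h1]; simp

theorem sublist_cons_iff_of_ne {a x : ℕ} (h : a ≠ x) {t l : List ℕ} :
    a :: t <+ x :: l ↔ a :: t <+ l := by
  constructor
  · intro hs
    rcases List.sublist_cons_iff.1 hs with hs | ⟨r, hr, _⟩
    · exact hs
    · exact absurd (List.cons.inj hr).1 h
  · exact fun hs => hs.cons _

/-- The leading `b`s and the letter satisfying `R'` can be matched greedily, ending at the pivot.
The pattern then occurs iff its remaining part occurs after the pivot, where
`exists_sublist_innerFlip` applies. -/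
theorem exists_sublist_pivotFlip (hb : ¬ R b) (hR : ∀ x, R' x → R x) (m n : ℕ) (l : List ℕ) :
    (∃ s r, (¬ R s ∧ s ≠ b) ∧ R' r ∧
      List.replicate m b ++ r :: (List.replicate n b ++ [s]) <+ pivotFlip R R' b m l) ↔
    ∃ s r, (¬ R s ∧ s ≠ b) ∧ R' r ∧ List.replicate m b ++ r :: s :: List.replicate n b <+ l := by
  induction l generalizing m with
  | nil => cases m <;> simp [pivotFlip]
  | cons x l ih =>
    rcases m with _ | m
    · simp only [List.replicate_zero, List.nil_append] at ih ⊢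
      by_cases h : R' x
      · have key : ∀ (f : ℕ → List ℕ) (L : List ℕ), (∃ s r, (¬ R s ∧ s ≠ b) ∧ R' r ∧
            r :: f s <+ x :: L) ↔ ∃ s, (¬ R s ∧ s ≠ b) ∧ f s <+ L := by
          intro f L
          constructor
          · rintro ⟨s, r, hs, hr, h'⟩
            exact ⟨s, hs, List.Sublist.tail h'⟩
          · rintro ⟨s, hs, h'⟩
            exact ⟨s, x, hs, h, h'.cons_cons x⟩
        rw [pivotFlip, if_pos h, key, key (fun s => s :: List.replicate n b)]
        exact exists_sublist_innerFlip hb (hR x h) l n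
      · rw [pivotFlip, if_neg h]
        have hne : ∀ r, R' r → r ≠ x := fun r hr e => h (e ▸ hr)
        refine Iff.trans ?_ ((ih 0).trans ?_)
        · exact exists_congr fun s => exists_congr fun r => and_congr_right fun hs =>
            and_congr_right fun hr => sublist_cons_iff_of_ne (hne r hr)
        · exact exists_congr fun s => exists_congr fun r => and_congr_right fun hs =>
            and_congr_right fun hr => (sublist_cons_iff_of_ne (hne r hr)).symm
    · rw [pivotFlip]
      by_cases h : x = b
      · subst h
        simpa only [if_true, List.replicate_succ, List.cons_append, List.cons_sublist_cons]
          using ih m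
      · rw [if_neg h]
        simpa only [List.replicate_succ, List.cons_append, sublist_cons_iff_of_ne (Ne.symm h)]
          using ih (m + 1)

end Pivot

/-! ### Replacing a factor inside a word. -/

section Congruence

theorem sublist_append_cases {u v A B : List ℕ} {y : ℕ} (h : u ++ y :: v <+ A ++ B) :
    (∃ v₁ v₂, v = v₁ ++ v₂ ∧ u ++ y :: v₁ <+ A ∧ v₂ <+ B) ∨
      ∃ u₁ u₂, u = u₁ ++ u₂ ∧ u₁ <+ A ∧ u₂ ++ y :: v <+ B := by
  obtain ⟨t1, t2, ht, h1, h2⟩ := List.sublist_append_iff.1 h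
  rcases List.append_eq_append_iff.1 ht with ⟨a, rfl, h3⟩ | ⟨a, h3, h4⟩
  · rcases a with _ | ⟨z, a⟩
    · exact .inr ⟨u, [], by simp, by simpa using h1, by simpa [h3] using h2⟩
    · simp only [List.cons_append, List.cons.injEq] at h3
      obtain ⟨rfl, rfl⟩ := h3
      exact .inl ⟨a, t2, rfl, h1, h2⟩
  · exact .inr ⟨t1, a, h3, h1, h4 ▸ h2⟩

theorem sublist_three_congr {P : ℕ → Prop} {D Q Q' Z t : List ℕ} (ht : ∀ x ∈ t, P x)
    (hQ : ∀ t, (∀ x ∈ t, P x) → t <+ Q → t <+ Q') (h : t <+ D ++ Q ++ Z) :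
    t <+ D ++ Q' ++ Z := by
  obtain ⟨t1, t2, rfl, h1, h2⟩ := List.sublist_append_iff.1 h
  obtain ⟨t3, t4, rfl, h3, h4⟩ := List.sublist_append_iff.1 h1
  exact (h3.append (hQ t4 (fun x hx => ht x (by simp [hx])) h4)).append h2

/-- If the exceptional letter is matched outside `Q`, only letters satisfying `P` fall into `Q`, so
`hQ` suffices. The case where it falls into `Q` is left to `hY`. -/
theorem exists_sublist_congr {P Y : ℕ → Prop} {D Q Q' Z u v : List ℕ} (hu : ∀ x ∈ u, P x)
    (hv : ∀ x ∈ v, P x) (hQ : ∀ t, (∀ x ∈ t, P x) → t <+ Q → t <+ Q')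
    (hY : ∀ u₁ u₂ v₁ v₂, u = u₁ ++ u₂ → v = v₁ ++ v₂ → u₁ <+ D → v₂ <+ Z →
      (∃ y, Y y ∧ u₂ ++ y :: v₁ <+ Q) → ∃ y, Y y ∧ u ++ y :: v <+ D ++ Q' ++ Z)
    (h : ∃ y, Y y ∧ u ++ y :: v <+ D ++ Q ++ Z) : ∃ y, Y y ∧ u ++ y :: v <+ D ++ Q' ++ Z := by
  obtain ⟨y, hy, h⟩ := h
  have hP : ∀ {t₁ t₂ : List ℕ}, (∀ x ∈ t₁ ++ t₂, P x) → (∀ x ∈ t₁, P x) ∧ ∀ x ∈ t₂, P x :=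
    fun h => ⟨fun x hx => h x (by simp [hx]), fun x hx => h x (by simp [hx])⟩
  rcases sublist_append_cases h with ⟨v1, v2, rfl, h1, h2⟩ | ⟨u1, u2, rfl, h1, h2⟩
  · rcases sublist_append_cases h1 with ⟨v3, v4, rfl, h3, h4⟩ | ⟨u1, u2, rfl, h3, h4⟩
    · refine ⟨y, hy, ?_⟩
      have := (h3.append (hQ v4 (hP (hP hv).1).2 h4)).append h2
      simpa using this
    · exact hY u1 u2 v1 v2 rfl rfl h3 h2 ⟨y, hy, h4⟩
  · refine ⟨y, hy, ?_⟩
    have := (sublist_three_congr (Z := []) (hP hu).1 hQ (by simpa using h1)).append h2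
    simpa using this

end Congruence

/-! ### Patterns that a step cannot affect. -/

section StepInvariance

variable {R R' : ℕ → Prop} [DecidablePred R] {b : ℕ} {left : Prop} {l l' : List ℕ}

theorem Step.perm (h : Step R R' b left l l') : l ~ l' := by
  rcases h with rfl | ⟨D, Q, Q', Z, rfl, rfl, h, -⟩
  · exact .refl _
  · exact (h.perm.append_left D).append_right Z

theorem Step.filter_run (h : Step R R' b left l l') : l.filter R = l'.filter R := by
  rcases h with rfl | ⟨D, Q, Q', Z, rfl, rfl, h, -⟩
  · rfl
  · simp only [List.filter_append, h.filter_run]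

theorem Step.filter_side (h : Step R R' b left l l') :
    l.filter (fun x => ¬ R x ∧ x ≠ b) = l'.filter (fun x => ¬ R x ∧ x ≠ b) := by
  rcases h with rfl | ⟨D, Q, Q', Z, rfl, rfl, h, -⟩
  · rfl
  · rw [List.filter_append, List.filter_append, h.filter_side, ← List.filter_append,
      ← List.filter_append]

theorem sublist_of_filter_eq {P : ℕ → Prop} [DecidablePred P] {Q Q' : List ℕ}
    (h : Q.filter P = Q'.filter P) : ∀ t, (∀ x ∈ t, P x) → t <+ Q → t <+ Q' := by
  intro t ht hs
  rwa [sublist_iff_sublist_filter ht, ← h, ← sublist_iff_sublist_filter ht]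

/-- Invariance for patterns all of whose letters but one satisfy `R`. -/
theorem Step.exists_sublist_run (h : Step R R' b left l l') {Y : ℕ → Prop}
    (hY : ∀ x, ¬ R x → Y x) {u v : List ℕ} (hu : ∀ x ∈ u, R x) (hv : ∀ x ∈ v, R x) (E : List ℕ)
    (hs : ∃ s, Y s ∧ u ++ s :: v <+ E ++ l) : ∃ s, Y s ∧ u ++ s :: v <+ E ++ l' := by
  rcases h with rfl | ⟨D, Q, Q', Z, rfl, rfl, h, -⟩
  · exact hs
  obtain ⟨s, hs, hsub⟩ := hs
  have hQ := sublist_of_filter_eq h.filter_run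
  simp only [← List.append_assoc] at hsub ⊢
  -- If the exceptional letter also satisfies `R`, the whole pattern consists of run letters, whose
  -- order is unchanged.
  by_cases hr : R s
  · refine ⟨s, hs, sublist_three_congr (P := R) ?_ hQ hsub⟩
    intro x hx
    simp only [List.mem_append, List.mem_cons] at hx
    rcases hx with h | rfl | h
    exacts [hu x h, hr, hv x h]
  · have := exists_sublist_congr (P := R) (Y := fun y => ¬ R y) hu hv hQ ?_ ⟨s, hr, hsub⟩
    · obtain ⟨y, hy, h'⟩ := this
      exact ⟨y, hY y hy, h'⟩
    · rintro u1 u2 v1 v2 rfl rfl h1 h2 h3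
      obtain ⟨y, hy, h3⟩ := (h.cross_iff u2 v1 (fun x hx => hu x (by simp [hx]))
        (fun x hx => hv x (by simp [hx]))).1 h3
      refine ⟨y, hy, ?_⟩
      have := (h1.append h3).append h2
      simpa using this

/-- Invariance for patterns all of whose letters but one neither satisfy `R` nor equal `b`. -/
theorem Step.exists_sublist_side (hb : ¬ R b) (hR : ∀ x, R' x → R x)
    (h : Step R R' b left l l') {Y : ℕ → Prop}
    (hY : ∀ x, R x → Y x) {u v : List ℕ} (hu : ∀ x ∈ u, ¬ R x ∧ x ≠ b)
    (hv : ∀ x ∈ v, ¬ R x ∧ x ≠ b) (hleft : left → v ≠ []) {E₁ E₂ : List ℕ}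
    (hE : ∀ x ∈ E₂, R x ∨ x = b) (hE' : ∀ r ∈ l, R' r → ∃ x ∈ E₂, R x)
    (hs : ∃ s, Y s ∧ u ++ s :: v <+ E₁ ++ E₂ ++ l) :
    ∃ s, Y s ∧ u ++ s :: v <+ E₁ ++ E₂ ++ l' := by
  rcases h with rfl | ⟨D, Q, Q', Z, rfl, rfl, h, hend⟩
  · exact hs
  obtain ⟨s, hs, hsub⟩ := hs
  have hQ := sublist_of_filter_eq h.filter_side
  -- The part before `Q` ends with a stretch free of side letters that contains a run letter: the
  -- pivot itself if it stands on the left, otherwise a letter of `E₂`.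
  obtain ⟨F₁, F₂, hF, hF2, r, hrF, hr⟩ : ∃ F₁ F₂, E₁ ++ E₂ ++ D = F₁ ++ F₂ ∧
      (∀ x ∈ F₂, R x ∨ x = b) ∧ ∃ r ∈ F₂, R r := by
    rcases hend with ⟨r, D₁, -, hr, rfl, -⟩ | ⟨r, Z₁, -, hr, rfl, rfl⟩
    · exact ⟨E₁ ++ E₂ ++ D₁, [r], by simp, by simp [hR r hr], r, by simp, hR r hr⟩
    · exact ⟨E₁, E₂, by simp, hE, hE' r (by simp) hr⟩
  rw [← List.append_assoc, ← List.append_assoc, hF] at hsub ⊢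
  by_cases hsS : ¬ R s ∧ s ≠ b
  · refine ⟨s, hs, sublist_three_congr (P := fun x => ¬ R x ∧ x ≠ b) ?_ hQ hsub⟩
    intro x hx
    simp only [List.mem_append, List.mem_cons] at hx
    rcases hx with h | rfl | h
    exacts [hu x h, hsS, hv x h]
  have hsR : R s ∨ s = b := by by_contra hc; exact hsS (not_or.1 hc)
  have := exists_sublist_congr (P := fun x => ¬ R x ∧ x ≠ b) (Y := fun y => (R y ∨ y = b) ∧ Y y)
    hu hv hQ ?_ ⟨s, ⟨hsR, hs⟩, hsub⟩
  · obtain ⟨y, hy, h'⟩ := this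
    exact ⟨y, hy.2, h'⟩
  rintro u1 u2 v1 v2 rfl rfl h1 h2 ⟨y, ⟨hyR, hyY⟩, h3⟩
  have hu2 : ∀ x ∈ u2, ¬ R x ∧ x ≠ b := fun x hx => hu x (by simp [hx])
  have hv1 : ∀ x ∈ v1, ¬ R x ∧ x ≠ b := fun x hx => hv x (by simp [hx])
  have hv2 : ∀ x ∈ v2, ¬ R x ∧ x ≠ b := fun x hx => hv x (by simp [hx])
  -- If no side letter of the pattern precedes the exceptional one inside `Q`, then `u` fits before
  -- `F₂`, and the run letter `r` of `F₂` takes over as the exceptional letter.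
  rcases eq_or_ne u2 [] with rfl | hu2'
  · have hu1 : u1 <+ F₁ := by
      obtain ⟨t1, t2, ht, h4, h5⟩ := List.sublist_append_iff.1 h1
      rcases t2 with _ | ⟨z, t2⟩
      · rw [List.append_nil] at ht
        rwa [ht]
      · have hz := hF2 z (h5.subset (by simp))
        have hz' := hu z (by simp [ht])
        exact absurd hz (not_or.2 hz')
    refine ⟨r, ⟨.inl hr, hY r hr⟩, ?_⟩
    have h4 := hQ v1 hv1 ((List.sublist_cons_self y v1).trans (by simpa using h3))
    have := ((hu1.append (List.singleton_sublist.2 hrF)).append h4).append h2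
    simpa using this
  rcases eq_or_ne v1 [] with rfl | hv1'
  -- If no side letter follows inside `Q`, a pivot on the right takes over as the exceptional
  -- letter. With the pivot on the left nothing comes after `Q`, so `v` would be empty, against
  -- `hleft`.
  · rcases hend with ⟨r', D₁, hl, hr', rfl, rfl⟩ | ⟨r', Z₁, -, hr', rfl, rfl⟩
    · exact absurd (List.sublist_nil.1 h2) (hleft hl)
    · refine ⟨r', ⟨.inl (hR r' hr'), hY r' (hR r' hr')⟩, ?_⟩
      have h4 := hQ u2 hu2 ((List.sublist_append_left u2 [y]).trans h3)
      have h5 : r' :: v2 <+ r' :: Z₁ := by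
        rcases v2 with _ | ⟨z, v2⟩
        · simp
        · have hz : z ≠ r' := fun e => (hv2 z (by simp)).1 (e ▸ hR r' hr')
          exact List.Sublist.cons_cons _ ((sublist_cons_iff_of_ne hz).1 h2)
      have := (h1.append h4).append h5
      simpa using this
  · have : ∃ y, (R y ∨ y = b) ∧ Y y ∧ u2 ++ y :: v1 <+ Q' := by
      rcases hyR with hyR | rfl
      · obtain ⟨y', hy', h4⟩ := (h.test_iff u2 v1 hu2' hv1' hu2 hv1).1 ⟨y, hyR, h3⟩
        exact ⟨y', .inl hy', hY y' hy', h4⟩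
      · exact ⟨y, .inr rfl, hyY, (h.test_iff' u2 v1 hu2' hv1' hu2 hv1).1 h3⟩
    obtain ⟨y', hy', hyY', h4⟩ := this
    refine ⟨y', ⟨hy', hyY'⟩, ?_⟩
    have := (h1.append h4).append h2
    simpa using this

end StepInvariance

/-! ### Restricted growth functions. -/

section Growth

/-- The word is a restricted growth function: before a letter `x`, all of `1, …, x - 1` occur. -/
def IsRGF (w : List ℕ) : Prop :=
  ∀ u x v, w = u ++ x :: v → 1 ≤ x ∧ ∀ y, 1 ≤ y → y < x → y ∈ u

theorem IsRGF.one_le {w : List ℕ} (h : IsRGF w) {x : ℕ} (hx : x ∈ w) : 1 ≤ x := by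
  obtain ⟨u, v, rfl⟩ := List.append_of_mem hx
  exact (h u x v rfl).1

theorem IsRGF.le_length {w : List ℕ} (h : IsRGF w) {x : ℕ} (hx : x ∈ w) : x ≤ w.length := by
  obtain ⟨u, v, rfl⟩ := List.append_of_mem hx
  have h1 : Finset.Icc 1 x ⊆ (u ++ x :: v).toFinset := by
    intro y hy
    rw [Finset.mem_Icc] at hy
    rcases hy.2.eq_or_lt with rfl | hlt
    · simp
    · simp [(h u x v rfl).2 y hy.1 hlt]
  have h2 := Finset.card_le_card h1
  rw [Nat.card_Icc] at h2
  exact le_trans (by omega) (h2.trans (List.toFinset_card_le _))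

/-- All letters before the first occurrence of `m` are smaller than `m`. -/
theorem IsRGF.lt_of_mem {P l : List ℕ} {m : ℕ} (h : IsRGF (P ++ m :: l)) (hm : m ∉ P) {x : ℕ}
    (hx : x ∈ P) : x < m := by
  obtain ⟨u, v, rfl⟩ := List.append_of_mem hx
  have h1 := (h u x (v ++ m :: l) (by simp)).2 m (h (u ++ x :: v) m l rfl).1
  by_contra hc
  rcases (not_lt.1 hc).eq_or_lt with rfl | hlt
  · simp at hm
  · exact hm (by simp [h1 hlt])

/-- A smaller letter required before `x` either stands in the fixed prefix or belongs, like `x`, to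
the class `p`, whose internal order is unchanged. -/
theorem IsRGF.of_rearrangement {P l l' : List ℕ} {m : ℕ} {p : ℕ → Prop} [DecidablePred p]
    (h : IsRGF (P ++ m :: l)) (hperm : l ~ l') (hp : l.filter p = l'.filter p)
    (hlow : ∀ x y, 1 ≤ y → y < x → (p x ∧ p y) ∨ y ∈ P ++ [m]) : IsRGF (P ++ m :: l') := by
  intro u x v huv
  have hx : x ∈ P ++ m :: l := by
    have : x ∈ P ++ m :: l' := by rw [huv]; simp
    simpa [hperm.mem_iff] using this
  refine ⟨h.one_le hx, fun y hy1 hyx => ?_⟩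
  rw [show P ++ m :: l' = (P ++ [m]) ++ l' by simp] at huv
  rcases List.append_eq_append_iff.1 huv with ⟨a, rfl, h1⟩ | ⟨a, h1, h2⟩
  · rcases hlow x y hy1 hyx with ⟨hpx, hpy⟩ | hmem
    · rw [h1, List.filter_append, List.filter_cons_of_pos (by simpa using hpx),
        List.filter_eq_append_iff] at hp
      obtain ⟨l₁, l₂, rfl, h3, h4⟩ := hp
      rw [List.filter_eq_cons_iff] at h4
      obtain ⟨l₃, l₄, rfl, h5, -, -⟩ := h4
      have := (h (P ++ m :: (l₁ ++ l₃)) x l₄ (by simp)).2 y hy1 hyx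
      simp only [List.mem_append, List.mem_cons] at this ⊢
      rcases this with h | h | h | h
      · simp [h]
      · simp [h]
      · have h6 : y ∈ a.filter p := by
          rw [← h3]; simp [h, hpy]
        exact .inr (List.mem_of_mem_filter h6)
      · exact absurd hpy (by simpa using h5 y h)
    · exact List.mem_append_left _ hmem
  · rcases a with _ | ⟨z, a⟩
    · rw [List.append_nil] at h1
      rcases hlow x y hy1 hyx with ⟨hpx, hpy⟩ | hmem
      · rw [List.nil_append] at h2
        rw [← h2, List.filter_cons_of_pos (by simpa using hpx), List.filter_eq_cons_iff] at hp
        obtain ⟨l₃, l₄, rfl, h5, -, -⟩ := hp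
        have := (h (P ++ m :: l₃) x l₄ (by simp)).2 y hy1 hyx
        rw [← h1]
        simp only [List.mem_append, List.mem_cons] at this ⊢
        rcases this with h | h | h
        · simp [h]
        · simp [h]
        · exact absurd hpy (by simpa using h5 y h)
      · rwa [← h1]
    · simp only [List.cons_append, List.cons.injEq] at h2
      obtain ⟨rfl, -⟩ := h2
      refine (h u x (a ++ l) ?_).2 y hy1 hyx
      rw [show P ++ m :: l = (P ++ [m]) ++ l by simp, h1]; simp

end Growth

/-! ### Acting after a first occurrence. -/

section AfterFirst

/-- Apply `f` to the part of the word after the first occurrence of `m`. -/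
def afterFirst (m : ℕ) (f : List ℕ → List ℕ) : List ℕ → List ℕ
  | [] => []
  | x :: l => if x = m then x :: f l else x :: afterFirst m f l

theorem afterFirst_of_notMem {m : ℕ} (f : List ℕ → List ℕ) {w : List ℕ} (h : m ∉ w) :
    afterFirst m f w = w := by
  induction w with
  | nil => rfl
  | cons x w ih =>
    simp only [List.mem_cons, not_or] at h
    rw [afterFirst, if_neg (Ne.symm h.1), ih h.2]

theorem afterFirst_append {m : ℕ} (f : List ℕ → List ℕ) {P : List ℕ} (h : m ∉ P) (l : List ℕ) :
    afterFirst m f (P ++ m :: l) = P ++ m :: f l := by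
  induction P with
  | nil => simp [afterFirst]
  | cons x P ih =>
    simp only [List.mem_cons, not_or] at h
    rw [List.cons_append, afterFirst, if_neg (Ne.symm h.1), ih h.2, List.cons_append]

theorem exists_first {m : ℕ} {w : List ℕ} (h : m ∈ w) : ∃ P l, w = P ++ m :: l ∧ m ∉ P := by
  induction w with
  | nil => simp at h
  | cons x w ih =>
    by_cases hx : x = m
    · exact ⟨[], w, by simp [hx], by simp⟩
    · obtain ⟨P, l, rfl, hP⟩ := ih (by simpa [Ne.symm hx] using h)
      exact ⟨x :: P, l, rfl, by simp [hP, Ne.symm hx]⟩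

theorem afterFirst_afterFirst {m : ℕ} {f : List ℕ → List ℕ} (hf : ∀ l, f (f l) = l)
    (w : List ℕ) : afterFirst m f (afterFirst m f w) = w := by
  by_cases h : m ∈ w
  · obtain ⟨P, l, rfl, hP⟩ := exists_first h
    rw [afterFirst_append f hP, afterFirst_append f hP, hf]
  · rw [afterFirst_of_notMem f h, afterFirst_of_notMem f h]

theorem cons_sublist_append_cons_iff {m : ℕ} {P t l : List ℕ} (h : m ∉ P) :
    m :: t <+ P ++ m :: l ↔ t <+ l := by
  induction P with
  | nil => simp
  | cons x P ih =>
    simp only [List.mem_cons, not_or] at h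
    rw [List.cons_append, sublist_cons_iff_of_ne h.1, ih h.2]

end AfterFirst

/-! ### Exchanging the forbidden patterns level by level. -/

section Counting

/-- The involution `φ k` turns the condition on `A k` into the one on `B k` and affects no other
level. Only finitely many levels can occur in a word of length `n`, so finitely many exchanges
suffice. -/
theorem card_levels_eq {A B : ℕ → List ℕ → Prop} (φ : ℕ → List ℕ → List ℕ) (n : ℕ)
    (hinv : ∀ k w, φ k (φ k w) = w) (hperm : ∀ k w, w ~ φ k w)
    (hrgf : ∀ k w, IsRGF w → IsRGF (φ k w))
    (hAB : ∀ k w, B k (φ k w) ↔ A k w)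
    (hA : ∀ j k w, j ≠ k → IsRGF w → (A j w → A j (φ k w)))
    (hB : ∀ j k w, j ≠ k → IsRGF w → (B j w → B j (φ k w)))
    (hA' : ∀ k w, A k w → ∃ m ∈ w, k ≤ m) (hB' : ∀ k w, B k w → ∃ m ∈ w, k ≤ m) :
    Nat.card {w : List ℕ // (IsRGF w ∧ w.length = n) ∧ ∀ k, ¬ A k w} =
      Nat.card {w : List ℕ // (IsRGF w ∧ w.length = n) ∧ ∀ k, ¬ B k w} := by
  have key : ∀ N, Nat.card {w : List ℕ // (IsRGF w ∧ w.length = n) ∧ ∀ k, ¬ A k w} =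
      Nat.card {w : List ℕ // (IsRGF w ∧ w.length = n) ∧
        (∀ k < N, ¬ B k w) ∧ ∀ k, N ≤ k → ¬ A k w} := by
    intro N
    induction N with
    | zero => simp
    | succ N ih =>
      rw [ih]
      have hlen : ∀ w, (φ N w).length = w.length := fun w => (hperm N w).length_eq.symm
      have hI : Function.Involutive (φ N) := hinv N
      refine Nat.card_congr (Equiv.subtypeEquiv hI.toPerm ?_)
      intro w
      rw [Function.Involutive.coe_toPerm, hlen]
      have hr : IsRGF (φ N w) ↔ IsRGF w :=
        ⟨fun h => by simpa [hinv] using hrgf N _ h, hrgf N w⟩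
      rw [hr]
      refine and_congr_right fun hw => ?_
      have hA2 : ∀ j, j ≠ N → (A j (φ N w) ↔ A j w) := fun j hj =>
        ⟨fun h => by simpa [hinv] using hA j N _ hj (hrgf N w hw.1) h, hA j N w hj hw.1⟩
      have hB2 : ∀ j, j ≠ N → (B j (φ N w) ↔ B j w) := fun j hj =>
        ⟨fun h => by simpa [hinv] using hB j N _ hj (hrgf N w hw.1) h, hB j N w hj hw.1⟩
      constructor
      · rintro ⟨h1, h2⟩
        refine ⟨fun k hk => ?_, fun k hk => ?_⟩
        · rcases (Nat.lt_succ_iff.1 hk).eq_or_lt with rfl | hlt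
          · rw [hAB]; exact h2 k le_rfl
          · rw [hB2 k hlt.ne]; exact h1 k hlt
        · rw [hA2 k (by omega)]; exact h2 k (by omega)
      · rintro ⟨h1, h2⟩
        refine ⟨fun k hk => ?_, fun k hk => ?_⟩
        · rw [← hB2 k hk.ne]; exact h1 k (by omega)
        · rcases hk.eq_or_lt with rfl | hlt
          · rw [← hAB]; exact h1 N (by omega)
          · rw [← hA2 k hlt.ne']; exact h2 k hlt
  -- The letters of a restricted growth function of length `n` are at most `n`, so all levels from
  -- `n + 1` on are vacuous.
  rw [key (n + 1)]
  refine Nat.card_congr (Equiv.subtypeEquivRight fun w => and_congr_right fun hw => ?_)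
  have hlarge : ∀ k m, m ∈ w → k ≤ m → k < n + 1 := fun k m hm hkm =>
    Nat.lt_succ_of_le (hkm.trans (hw.2 ▸ hw.1.le_length hm))
  constructor
  · rintro ⟨h1, -⟩ k hk
    obtain ⟨m, hm, hkm⟩ := hB' k w hk
    exact h1 k (hlarge k m hm hkm) hk
  · intro h
    refine ⟨fun k _ => h k, fun k hk hAk => ?_⟩
    obtain ⟨m, hm, hkm⟩ := hA' k w hAk
    exact absurd (hlarge k m hm hkm) (by omega)

end Counting

/-! ### Independence of the levels. -/

section Levels

/-- A pattern `T k s r` in which `s` and `r` occur once each and all other letters are `k`. -/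
structure HasWild (left : Prop) (T : ℕ → ℕ → ℕ → List ℕ) : Prop where
  side : ∀ k r, ∃ u v, (∀ x ∈ u, x = k ∨ x = r) ∧ (∀ x ∈ v, x = k ∨ x = r) ∧
    ∀ s, T k s r = u ++ s :: v
  run : ∀ k s, ∃ u v, (∀ x ∈ u, x = k ∨ x = s) ∧ (∀ x ∈ v, x = k ∨ x = s) ∧ (left → v ≠ []) ∧
    ∀ r, T k s r = u ++ r :: v

/-- An occurrence of `T k s r` with `s < k` and `r > k + 1`, after an occurrence of `k + 1`. -/
def LowLevel (T : ℕ → ℕ → ℕ → List ℕ) (k : ℕ) (w : List ℕ) : Prop :=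
  ∃ s r, s < k ∧ k + 1 < r ∧ (k + 1) :: T k s r <+ w

/-- An occurrence of `T k s r` with `s > k` and `r < k - 1`, after an occurrence of `k`. -/
def HighLevel (T : ℕ → ℕ → ℕ → List ℕ) (k : ℕ) (w : List ℕ) : Prop :=
  ∃ s r, k < s ∧ r + 1 < k ∧ k :: T k s r <+ w

variable {left : Prop} {T : ℕ → ℕ → ℕ → List ℕ} {j k : ℕ} {P l l' : List ℕ}

theorem LowLevel.step (hT : HasWild left T) (hjk : j ≠ k) (hw : IsRGF (P ++ (k + 1) :: l))
    (hs : Step (fun x => k < x) (fun x => k + 1 < x) k left l l')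
    (h : LowLevel T j (P ++ (k + 1) :: l)) : LowLevel T j (P ++ (k + 1) :: l') := by
  obtain ⟨s, r, hsj, hjr, h⟩ := h
  rcases hjk.lt_or_gt with hlt | hgt
  -- The leading `j + 1` may equal `k`, which is not a side letter, so it is matched at its first
  -- occurrence, in the fixed prefix. What remains consists of letters below `k`, except for the
  -- free `r`.
  · have hm : j + 1 ∈ P := (hw P (k + 1) l rfl).2 (j + 1) (by omega) (by omega)
    obtain ⟨P₀, P₁, rfl, hP₀⟩ := exists_first hm
    rw [List.append_assoc, List.cons_append, cons_sublist_append_cons_iff hP₀] at h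
    obtain ⟨u, v, hu, hv, hl, hT⟩ := hT.run j s
    rw [hT] at h
    have := hs.exists_sublist_side (Y := fun x => j + 1 < x) (u := u) (v := v) (E₁ := P₁)
      (E₂ := [k + 1]) (by simp) (fun x hx => by omega) (fun x hx => by omega)
      (fun x hx => by rcases hu x hx with rfl | rfl <;> omega)
      (fun x hx => by rcases hv x hx with rfl | rfl <;> omega) hl (by simp) (by simp)
      ⟨r, hjr, by simpa using h⟩
    obtain ⟨r', hr', h'⟩ := this
    refine ⟨s, r', hsj, hr', ?_⟩
    rw [List.append_assoc, List.cons_append, cons_sublist_append_cons_iff hP₀, hT]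
    simpa using h'
  -- Here `j`, `j + 1` and `r` all exceed `k`, so only `s` can fail to be a run letter.
  · obtain ⟨u, v, hu, hv, hT⟩ := hT.side j r
    rw [hT] at h
    have := hs.exists_sublist_run (Y := fun x => x < j) (u := (j + 1) :: u) (v := v)
      (fun x hx => by omega)
      (fun x hx => by
        rcases List.mem_cons.1 hx with rfl | hx
        · omega
        · rcases hu x hx with rfl | rfl <;> omega)
      (fun x hx => by rcases hv x hx with rfl | rfl <;> omega) (P ++ [k + 1])
      ⟨s, hsj, by simpa using h⟩
    obtain ⟨s', hs', h'⟩ := this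
    refine ⟨s', r, hs', hjr, ?_⟩
    rw [hT]
    simpa using h'

theorem HighLevel.step (hT : HasWild left T) (hjk : j ≠ k) (hw : IsRGF (P ++ k :: l))
    (hP : k ∉ P) (hs : Step (fun x => x < k) (fun x => x + 1 < k) k left l l')
    (h : HighLevel T j (P ++ k :: l)) : HighLevel T j (P ++ k :: l') := by
  obtain ⟨s, r, hsj, hjr, h⟩ := h
  rcases hjk.lt_or_gt with hlt | hgt
  · obtain ⟨u, v, hu, hv, hT⟩ := hT.side j r
    rw [hT] at h
    have := hs.exists_sublist_run (Y := fun x => j < x) (u := j :: u) (v := v)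
      (fun x hx => by omega)
      (fun x hx => by
        rcases List.mem_cons.1 hx with rfl | hx
        · omega
        · rcases hu x hx with rfl | rfl <;> omega)
      (fun x hx => by rcases hv x hx with rfl | rfl <;> omega) (P ++ [k])
      ⟨s, hsj, by simpa using h⟩
    obtain ⟨s', hs', h'⟩ := this
    refine ⟨s', r, hs', hjr, ?_⟩
    rw [hT]
    simpa using h'
  · obtain ⟨u, v, hu, hv, hl, hT⟩ := hT.run j s
    rw [hT] at h
    -- All letters up to the first `k` are at most `k`. Any letter below `k - 1` in `l` already
    -- occurs in `P`, which supplies the run letter needed before `l`.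
    have := hs.exists_sublist_side (Y := fun x => x + 1 < j) (u := j :: u) (v := v) (E₁ := [])
      (E₂ := P ++ [k]) (by simp) (fun x hx => by omega) (fun x hx => by omega)
      (fun x hx => by
        rcases List.mem_cons.1 hx with rfl | hx
        · omega
        · rcases hu x hx with rfl | rfl <;> omega)
      (fun x hx => by rcases hv x hx with rfl | rfl <;> omega) hl
      (fun x hx => by
        rcases List.mem_append.1 hx with hx | hx
        · exact .inl (hw.lt_of_mem hP hx)
        · exact .inr (List.mem_singleton.1 hx))
      (fun r hr hrk => by
        have h1 := hw.one_le (x := r) (by simp [hr])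
        exact ⟨r, List.mem_append_left _ ((hw P k l rfl).2 r h1 (by omega)), by omega⟩)
      ⟨r, hjr, by simpa using h⟩
    obtain ⟨r', hr', h'⟩ := this
    refine ⟨s, r', hsj, hr', ?_⟩
    rw [hT]
    simpa using h'

theorem card_lowLevel_eq {A B : ℕ → ℕ → ℕ → List ℕ} (hA : HasWild left A) (hB : HasWild left B)
    (f : ℕ → List ℕ → List ℕ) (hinv : ∀ k l, f k (f k l) = l)
    (hstep : ∀ k l, Step (fun x => k < x) (fun x => k + 1 < x) k left l (f k l))
    (hAB : ∀ k l, (∃ s r, (¬ k < s ∧ s ≠ k) ∧ k + 1 < r ∧ B k s r <+ f k l) ↔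
      ∃ s r, (¬ k < s ∧ s ≠ k) ∧ k + 1 < r ∧ A k s r <+ l) (n : ℕ) :
    Nat.card {w : List ℕ // (IsRGF w ∧ w.length = n) ∧ ∀ k, ¬ LowLevel A k w} =
      Nat.card {w : List ℕ // (IsRGF w ∧ w.length = n) ∧ ∀ k, ¬ LowLevel B k w} := by
  have hside : ∀ k s : ℕ, (¬ k < s ∧ s ≠ k) ↔ s < k := fun k s => by omega
  have hoff : ∀ T, HasWild left T → ∀ j k w, j ≠ k → IsRGF w → LowLevel T j w →
      LowLevel T j (afterFirst (k + 1) (f k) w) := by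
    intro T hT j k w hjk hw h
    by_cases hm : k + 1 ∈ w
    · obtain ⟨P, l, rfl, hP⟩ := exists_first hm
      rw [afterFirst_append _ hP]
      exact h.step hT hjk hw (hstep k l)
    · rwa [afterFirst_of_notMem _ hm]
  have hmem : ∀ T k w, LowLevel T k w → ∃ m ∈ w, k ≤ m := by
    rintro T k w ⟨s, r, -, -, h⟩
    exact ⟨k + 1, h.subset (by simp), by omega⟩
  refine card_levels_eq (fun k => afterFirst (k + 1) (f k)) n
    (fun k w => afterFirst_afterFirst (hinv k) w) ?_ ?_ ?_ (hoff A hA) (hoff B hB) (hmem A) (hmem B)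
  · intro k w
    by_cases hm : k + 1 ∈ w
    · obtain ⟨P, l, rfl, hP⟩ := exists_first hm
      rw [afterFirst_append _ hP]
      exact ((hstep k l).perm.cons _).append_left P
    · rw [afterFirst_of_notMem _ hm]
  · intro k w hw
    by_cases hm : k + 1 ∈ w
    · obtain ⟨P, l, rfl, hP⟩ := exists_first hm
      rw [afterFirst_append _ hP]
      -- All letters up to `k` already occur before the first `k + 1`, and the letters above `k`
      -- keep their order.
      refine hw.of_rearrangement (hstep k l).perm (hstep k l).filter_run fun x y hy hyx => ?_
      by_cases hyk : k < y
      · exact .inl ⟨by omega, hyk⟩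
      · exact .inr (List.mem_append_left _ ((hw P (k + 1) l rfl).2 y hy (by omega)))
    · rwa [afterFirst_of_notMem _ hm]
  · intro k w
    by_cases hm : k + 1 ∈ w
    · obtain ⟨P, l, rfl, hP⟩ := exists_first hm
      rw [afterFirst_append _ hP]
      simpa only [LowLevel, cons_sublist_append_cons_iff hP, hside] using hAB k l
    · rw [afterFirst_of_notMem _ hm]
      refine iff_of_false ?_ ?_ <;>
      · rintro ⟨s, r, -, -, h⟩
        exact hm (h.subset (by simp))

theorem card_highLevel_eq {A B : ℕ → ℕ → ℕ → List ℕ} (hA : HasWild left A) (hB : HasWild left B)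
    (f : ℕ → List ℕ → List ℕ) (hinv : ∀ k l, f k (f k l) = l)
    (hstep : ∀ k l, Step (fun x => x < k) (fun x => x + 1 < k) k left l (f k l))
    (hAB : ∀ k l, (∃ s r, (¬ s < k ∧ s ≠ k) ∧ r + 1 < k ∧ B k s r <+ f k l) ↔
      ∃ s r, (¬ s < k ∧ s ≠ k) ∧ r + 1 < k ∧ A k s r <+ l) (n : ℕ) :
    Nat.card {w : List ℕ // (IsRGF w ∧ w.length = n) ∧ ∀ k, ¬ HighLevel A k w} =
      Nat.card {w : List ℕ // (IsRGF w ∧ w.length = n) ∧ ∀ k, ¬ HighLevel B k w} := by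
  have hside : ∀ k s : ℕ, (¬ s < k ∧ s ≠ k) ↔ k < s := fun k s => by omega
  have hoff : ∀ T, HasWild left T → ∀ j k w, j ≠ k → IsRGF w → HighLevel T j w →
      HighLevel T j (afterFirst k (f k) w) := by
    intro T hT j k w hjk hw h
    by_cases hm : k ∈ w
    · obtain ⟨P, l, rfl, hP⟩ := exists_first hm
      rw [afterFirst_append _ hP]
      exact h.step hT hjk hw hP (hstep k l)
    · rwa [afterFirst_of_notMem _ hm]
  have hmem : ∀ T k w, HighLevel T k w → ∃ m ∈ w, k ≤ m := by
    rintro T k w ⟨s, r, -, -, h⟩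
    exact ⟨k, h.subset (by simp), le_rfl⟩
  refine card_levels_eq (fun k => afterFirst k (f k)) n
    (fun k w => afterFirst_afterFirst (hinv k) w) ?_ ?_ ?_ (hoff A hA) (hoff B hB) (hmem A) (hmem B)
  · intro k w
    by_cases hm : k ∈ w
    · obtain ⟨P, l, rfl, hP⟩ := exists_first hm
      rw [afterFirst_append _ hP]
      exact ((hstep k l).perm.cons _).append_left P
    · rw [afterFirst_of_notMem _ hm]
  · intro k w hw
    by_cases hm : k ∈ w
    · obtain ⟨P, l, rfl, hP⟩ := exists_first hm
      rw [afterFirst_append _ hP]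
      refine hw.of_rearrangement (hstep k l).perm (hstep k l).filter_side fun x y hy hyx => ?_
      rcases lt_trichotomy y k with hyk | rfl | hyk
      · exact .inr (List.mem_append_left _ ((hw P k l rfl).2 y hy hyk))
      · exact .inr (by simp)
      · exact .inl (by omega)
    · rwa [afterFirst_of_notMem _ hm]
  · intro k w
    by_cases hm : k ∈ w
    · obtain ⟨P, l, rfl, hP⟩ := exists_first hm
      rw [afterFirst_append _ hP]
      simpa only [HighLevel, cons_sublist_append_cons_iff hP, hside] using hAB k l
    · rw [afterFirst_of_notMem _ hm]
      refine iff_of_false ?_ ?_ <;>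
      · rintro ⟨s, r, -, -, h⟩
        exact hm (h.subset (by simp))

end Levels

/-! ### The four pattern shapes. -/

section Patterns

variable (p q : ℕ)

theorem hasWild_run_side :
    HasWild True (fun k s r => List.replicate p k ++ r :: s :: List.replicate q k) where
  side k r := ⟨List.replicate p k ++ [r], List.replicate q k,
    by simp +contextual [or_imp], by simp +contextual, by simp⟩
  run k s := ⟨List.replicate p k, s :: List.replicate q k, by simp +contextual,
    by simp +contextual, by simp, by simp⟩

theorem hasWild_run_side_last :
    HasWild True (fun k s r => List.replicate p k ++ r :: (List.replicate q k ++ [s])) where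
  side k r := ⟨List.replicate p k ++ r :: List.replicate q k, [],
    by simp +contextual [or_imp], by simp, by simp⟩
  run k s := ⟨List.replicate p k, List.replicate q k ++ [s], by simp +contextual,
    by simp +contextual [or_imp], by simp, by simp⟩

theorem hasWild_side_run :
    HasWild False (fun k s r => List.replicate p k ++ s :: r :: List.replicate q k) where
  side k r := ⟨List.replicate p k, r :: List.replicate q k,
    by simp +contextual, by simp +contextual, by simp⟩
  run k s := ⟨List.replicate p k ++ [s], List.replicate q k, by simp +contextual [or_imp],
    by simp +contextual, by simp, by simp⟩

theorem hasWild_side_first_run :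
    HasWild False (fun k s r => s :: (List.replicate p k ++ r :: List.replicate q k)) where
  side k r := ⟨[], List.replicate p k ++ r :: List.replicate q k,
    by simp, by simp +contextual [or_imp], by simp⟩
  run k s := ⟨s :: List.replicate p k, List.replicate q k, by simp +contextual,
    by simp +contextual, by simp, by simp⟩

/-- Reversal turns these shapes into those of `exists_sublist_pivotFlip`, with the two exponents
interchanged. -/
theorem exists_sublist_reverse_pivotFlip {R R' : ℕ → Prop} [DecidablePred R] [DecidablePred R']
    {b : ℕ} (hb : ¬ R b) (hR : ∀ x, R' x → R x) (l : List ℕ) :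
    (∃ s r, (¬ R s ∧ s ≠ b) ∧ R' r ∧ s :: (List.replicate p b ++ r :: List.replicate q b) <+
      (pivotFlip R R' b q l.reverse).reverse) ↔
    ∃ s r, (¬ R s ∧ s ≠ b) ∧ R' r ∧ List.replicate p b ++ s :: r :: List.replicate q b <+ l := by
  have h := exists_sublist_pivotFlip hb hR q p l.reverse
  refine Iff.trans ?_ (h.trans ?_)
  · refine exists_congr fun s => exists_congr fun r => and_congr_right fun _ =>
      and_congr_right fun _ => ?_
    rw [← List.reverse_sublist]; simp
  · refine exists_congr fun s => exists_congr fun r => and_congr_right fun _ =>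
      and_congr_right fun _ => ?_
    rw [← List.reverse_sublist]; simp

variable (n : ℕ)

theorem card_low_left :
    Nat.card {w : List ℕ // (IsRGF w ∧ w.length = n) ∧ ∀ k, ¬ LowLevel
      (fun k s r => List.replicate p k ++ r :: s :: List.replicate q k) k w} =
    Nat.card {w : List ℕ // (IsRGF w ∧ w.length = n) ∧ ∀ k, ¬ LowLevel
      (fun k s r => List.replicate p k ++ r :: (List.replicate q k ++ [s])) k w} :=
  card_lowLevel_eq (hasWild_run_side p q) (hasWild_run_side_last p q)
    (fun k => pivotFlip (fun x => k < x) (fun x => k + 1 < x) k p)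
    (fun k => pivotFlip_pivotFlip (by simp) (fun x hx => by omega) p)
    (fun k => step_pivotFlip (by simp) (fun x hx => by omega) p)
    (fun k => exists_sublist_pivotFlip (by simp) (fun x hx => by omega) p q) n

theorem card_low_right :
    Nat.card {w : List ℕ // (IsRGF w ∧ w.length = n) ∧ ∀ k, ¬ LowLevel
      (fun k s r => List.replicate p k ++ s :: r :: List.replicate q k) k w} =
    Nat.card {w : List ℕ // (IsRGF w ∧ w.length = n) ∧ ∀ k, ¬ LowLevel
      (fun k s r => s :: (List.replicate p k ++ r :: List.replicate q k)) k w} :=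
  card_lowLevel_eq (hasWild_side_run p q) (hasWild_side_first_run p q)
    (fun k l => (pivotFlip (fun x => k < x) (fun x => k + 1 < x) k q l.reverse).reverse)
    (fun k l => by
      rw [List.reverse_reverse, pivotFlip_pivotFlip (by simp) (fun x hx => by omega),
        List.reverse_reverse])
    (fun k => step_reverse_pivotFlip (by simp) (fun x hx => by omega) q)
    (fun k => exists_sublist_reverse_pivotFlip p q (by simp) (fun x hx => by omega)) n

theorem card_high_left :
    Nat.card {w : List ℕ // (IsRGF w ∧ w.length = n) ∧ ∀ k, ¬ HighLevel
      (fun k s r => List.replicate p k ++ r :: s :: List.replicate q k) k w} =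
    Nat.card {w : List ℕ // (IsRGF w ∧ w.length = n) ∧ ∀ k, ¬ HighLevel
      (fun k s r => List.replicate p k ++ r :: (List.replicate q k ++ [s])) k w} :=
  card_highLevel_eq (hasWild_run_side p q) (hasWild_run_side_last p q)
    (fun k => pivotFlip (fun x => x < k) (fun x => x + 1 < k) k p)
    (fun k => pivotFlip_pivotFlip (by simp) (fun x hx => by omega) p)
    (fun k => step_pivotFlip (by simp) (fun x hx => by omega) p)
    (fun k => exists_sublist_pivotFlip (by simp) (fun x hx => by omega) p q) n

theorem card_high_right :
    Nat.card {w : List ℕ // (IsRGF w ∧ w.length = n) ∧ ∀ k, ¬ HighLevel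
      (fun k s r => List.replicate p k ++ s :: r :: List.replicate q k) k w} =
    Nat.card {w : List ℕ // (IsRGF w ∧ w.length = n) ∧ ∀ k, ¬ HighLevel
      (fun k s r => s :: (List.replicate p k ++ r :: List.replicate q k)) k w} :=
  card_highLevel_eq (hasWild_side_run p q) (hasWild_side_first_run p q)
    (fun k l => (pivotFlip (fun x => x < k) (fun x => x + 1 < k) k q l.reverse).reverse)
    (fun k l => by
      rw [List.reverse_reverse, pivotFlip_pivotFlip (by simp) (fun x hx => by omega),
        List.reverse_reverse])
    (fun k => step_reverse_pivotFlip (by simp) (fun x hx => by omega) q)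
    (fun k => exists_sublist_reverse_pivotFlip p q (by simp) (fun x hx => by omega)) n

end Patterns

/-! ### Partitions as restricted growth functions. -/

section Canonical

variable {n : ℕ}

theorem isRGF_ofFn_iff {s : Fin n → ℕ} : IsRGF (List.ofFn s) ↔
    ∀ i, 1 ≤ s i ∧ ∀ y, 1 ≤ y → y < s i → ∃ j < i, s j = y := by
  constructor
  · intro h i
    have hi : (i : ℕ) < (List.ofFn s).length := by simp
    have hd : List.ofFn s = (List.ofFn s).take i ++ s i :: (List.ofFn s).drop (i + 1) := by
      conv_lhs => rw [← List.take_append_drop i (List.ofFn s), List.drop_eq_getElem_cons hi]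
      simp
    obtain ⟨h1, h2⟩ := h _ _ _ hd
    refine ⟨h1, fun y hy hlt => ?_⟩
    obtain ⟨j, hj, hjy⟩ := List.mem_iff_getElem.1 (h2 y hy hlt)
    simp only [List.length_take, List.length_ofFn, lt_inf_iff] at hj
    refine ⟨⟨j, hj.2⟩, hj.1, ?_⟩
    simpa using hjy
  · intro h u x v huv
    have hlen : u.length < n := by
      have := congrArg List.length huv
      simp at this; omega
    have hx : s ⟨u.length, hlen⟩ = x := by
      have : (List.ofFn s)[u.length]'(by simpa using hlen) = x := by simp [huv]
      simpa using this
    obtain ⟨h1, h2⟩ := h ⟨u.length, hlen⟩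
    rw [hx] at h1 h2
    refine ⟨h1, fun y hy hlt => ?_⟩
    obtain ⟨j, hj, rfl⟩ := h2 y hy hlt
    have hj' : (j : ℕ) < u.length := hj
    have : (List.ofFn s)[(j : ℕ)]'(by simp) = u[(j : ℕ)] := by simp [huv, List.getElem_append_left hj']
    rw [List.getElem_ofFn] at this
    rw [show s j = u[(j : ℕ)] from this]
    exact List.getElem_mem hj'

/-- Restricted growth functions that induce the same equivalence relation are equal. -/
theorem eq_of_isRGF_of_iff {s t : Fin n → ℕ} (hs : IsRGF (List.ofFn s)) (ht : IsRGF (List.ofFn t))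
    (h : ∀ i j, s i = s j ↔ t i = t j) : s = t := by
  rw [isRGF_ofFn_iff] at hs ht
  funext i
  induction i using WellFoundedLT.induction with
  | _ i ih =>
    by_cases hex : ∃ j < i, s j = s i
    · obtain ⟨j, hj, hji⟩ := hex
      rw [← hji, ih j hj, (h j i).1 hji]
    · rcases lt_trichotomy (s i) (t i) with hlt | heq | hgt
      · obtain ⟨j, hj, hji⟩ := (ht i).2 _ (hs i).1 hlt
        exact absurd ⟨j, hj, (ih j hj).trans hji⟩ hex
      · exact heq
      · obtain ⟨j, hj, hji⟩ := (hs i).2 _ (ht i).1 hgt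
        exact absurd ⟨j, hj, (h j i).2 ((ih j hj).symm.trans hji)⟩ hex

theorem part_eq_of_min_eq (π : Part n) {B C : Finset (Fin n)} (hB : B ∈ π.parts) (hC : C ∈ π.parts)
    (h : B.min = C.min) : B = C := by
  obtain ⟨a, ha⟩ := Finset.min_of_nonempty (π.nonempty_of_mem_parts hB)
  exact π.eq_of_mem_parts hB hC (Finset.mem_of_min ha) (Finset.mem_of_min (h ▸ ha))

theorem part_mem' (π : Part n) (i : Fin n) : π.part i ∈ π.parts := π.part_mem.2 (mem_univ i)

theorem mem_part' (π : Part n) (i : Fin n) : i ∈ π.part i := π.mem_part (mem_univ i)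

theorem canonicalSeq_eq_iff (π : Part n) (i j : Fin n) :
    canonicalSeq π i = canonicalSeq π j ↔ π.part i = π.part j := by
  constructor
  · intro h
    wlog hle : (π.part i).min ≤ (π.part j).min generalizing i j
    · exact (this j i h.symm (le_of_not_ge hle)).symm
    have hsub : {B ∈ π.parts | B.min ≤ (π.part i).min} ⊆ {B ∈ π.parts | B.min ≤ (π.part j).min} := by
      intro B hB
      rw [mem_filter] at hB ⊢
      exact ⟨hB.1, hB.2.trans hle⟩
    have heq := Finset.eq_of_subset_of_card_le hsub h.ge
    have hj : π.part j ∈ ({B ∈ π.parts | B.min ≤ (π.part j).min} : Finset _) :=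
      mem_filter.2 ⟨part_mem' π j, le_rfl⟩
    rw [← heq, mem_filter] at hj
    exact part_eq_of_min_eq π (part_mem' π i) (part_mem' π j) (le_antisymm hle hj.2)
  · intro h
    rw [canonicalSeq, canonicalSeq, h]

theorem canonicalSeq_injective : Function.Injective (canonicalSeq (n := n)) := by
  have hsub : ∀ π π' : Part n, canonicalSeq π = canonicalSeq π' → π.parts ⊆ π'.parts := by
    intro π π' h B hB
    obtain ⟨i, hi⟩ := π.nonempty_of_mem_parts hB
    have h1 : B = π.part i := π.eq_of_mem_parts hB (part_mem' π i) hi (mem_part' π i)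
    have h2 : π.part i = π'.part i := by
      ext j
      have e : ∀ π : Part n, j ∈ π.part i ↔ canonicalSeq π j = canonicalSeq π i := by
        intro π
        rw [canonicalSeq_eq_iff]
        constructor
        · intro hj
          exact π.eq_of_mem_parts (part_mem' π j) (part_mem' π i) (mem_part' π j) hj
        · intro hj
          rw [← hj]; exact mem_part' π j
      rw [e, e, h]
    rw [h1, h2]
    exact part_mem' π' i
  intro π π' h
  exact Finpartition.ext (Subset.antisymm (hsub π π' h) (hsub π' π h.symm))

theorem isRGF_canonicalSeq (π : Part n) : IsRGF (List.ofFn (canonicalSeq π)) := by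
  rw [isRGF_ofFn_iff]
  intro i
  have hpos : ∀ i, 1 ≤ canonicalSeq π i := by
    intro i
    exact Finset.card_pos.2 ⟨π.part i, mem_filter.2 ⟨part_mem' π i, le_rfl⟩⟩
  refine ⟨hpos i, fun y hy hlt => ?_⟩
  -- `S` collects the minima of the blocks counted by `canonicalSeq π i`. The canonical sequence
  -- maps it injectively into `1, …, canonicalSeq π i`, hence onto by cardinality, so every smaller
  -- value is taken at a block minimum that is at most `i`.
  set S : Finset (Fin n) := {j | (π.part j).min ≤ (π.part i).min ∧ (π.part j).min = j}
  have hmin : ∀ B ∈ π.parts, ∃ j, B.min = ((j : Fin n) : WithTop (Fin n)) ∧ B = π.part j := by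
    intro B hB
    obtain ⟨j, hj⟩ := Finset.min_of_nonempty (π.nonempty_of_mem_parts hB)
    exact ⟨j, hj, π.eq_of_mem_parts hB (part_mem' π j) (Finset.mem_of_min hj) (mem_part' π j)⟩
  have hcard : #(Icc 1 (canonicalSeq π i)) ≤ #S := by
    rw [Nat.card_Icc, Nat.add_sub_cancel]
    refine Finset.card_le_card_of_surjOn π.part ?_
    intro B hB
    simp only [coe_filter, Set.mem_ofPred_eq] at hB
    obtain ⟨j, hj, hBj⟩ := hmin B hB.1
    refine ⟨j, ?_, hBj.symm⟩
    simp only [S, coe_filter, mem_univ, true_and, Set.mem_ofPred_eq]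
    exact hBj ▸ ⟨hB.2, hj⟩
  have hmaps : ∀ j ∈ S, canonicalSeq π j ∈ Icc 1 (canonicalSeq π i) := by
    intro j hj
    simp only [S, mem_filter, mem_univ, true_and] at hj
    rw [mem_Icc]
    refine ⟨hpos j, Finset.card_le_card fun B hB => ?_⟩
    rw [mem_filter] at hB ⊢
    exact ⟨hB.1, hB.2.trans hj.1⟩
  have hinj : Set.InjOn (canonicalSeq π) S := by
    intro j hj j' hj' h
    rw [canonicalSeq_eq_iff] at h
    simp only [S, coe_filter, mem_univ, true_and, Set.mem_ofPred_eq] at hj hj'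
    have := hj.2.symm.trans ((congrArg Finset.min h).trans hj'.2)
    exact_mod_cast this
  have hsurj := Finset.surjOn_of_injOn_of_card_le (canonicalSeq π) hmaps hinj hcard
  obtain ⟨j, hj, hjy⟩ := hsurj (by simpa using ⟨hy, hlt.le⟩ : y ∈ (Icc 1 (canonicalSeq π i) : Set ℕ))
  simp only [S, coe_filter, mem_univ, true_and, Set.mem_ofPred_eq] at hj
  refine ⟨j, ?_, hjy⟩
  have hji : j ≤ i := by
    have := hj.2 ▸ hj.1.trans (Finset.min_le (mem_part' π i))
    exact_mod_cast this
  refine lt_of_le_of_ne hji ?_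
  rintro rfl
  omega

theorem exists_canonicalSeq_eq {s : Fin n → ℕ} (hs : IsRGF (List.ofFn s)) :
    ∃ π : Part n, canonicalSeq π = s := by
  classical
  let π : Part n := Finpartition.ofSetoid (Setoid.ker s)
  refine ⟨π, eq_of_isRGF_of_iff (isRGF_canonicalSeq π) hs fun i j => ?_⟩
  rw [canonicalSeq_eq_iff]
  have hm : ∀ i j, j ∈ π.part i ↔ s i = s j := fun i j =>
    Finpartition.mem_part_ofSetoid_iff_rel
  constructor
  · intro h
    exact ((hm j i).1 (h ▸ mem_part' π i)).symm
  · intro h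
    exact π.eq_of_mem_parts (part_mem' π i) (part_mem' π j) (mem_part' π i) ((hm j i).2 h.symm)

/-- Partitions whose canonical sequence has a given property correspond to restricted growth
functions with that property. -/
theorem card_part_eq {F : (Fin n → ℕ) → Prop} {G : List ℕ → Prop}
    (h : ∀ s, IsRGF (List.ofFn s) → (F s ↔ G (List.ofFn s))) :
    Nat.card {π : Part n // F (canonicalSeq π)} =
      Nat.card {w : List ℕ // (IsRGF w ∧ w.length = n) ∧ G w} := by
  refine Nat.card_congr (Equiv.ofBijective (fun π => ⟨List.ofFn (canonicalSeq π.1),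
    ⟨isRGF_canonicalSeq π.1, by simp⟩, (h _ (isRGF_canonicalSeq π.1)).1 π.2⟩) ⟨?_, ?_⟩)
  · rintro ⟨π, hπ⟩ ⟨π', hπ'⟩ heq
    simp only [Subtype.mk.injEq] at heq ⊢
    exact canonicalSeq_injective (List.ofFn_injective heq)
  · rintro ⟨w, ⟨hw, rfl⟩, hG⟩
    have hget : List.ofFn w.get = w := List.ofFn_get w
    obtain ⟨π, hπ⟩ := exists_canonicalSeq_eq (s := w.get) (by rwa [hget])
    refine ⟨⟨π, ?_⟩, ?_⟩
    · rw [h _ (isRGF_canonicalSeq π), hπ, hget]; exact hG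
    · simp only [hπ, hget]

end Canonical

/-! ### From pattern containment to levels. -/

section Containment

/-- The substitution `1 ↦ a`, `2 ↦ b`, `3 ↦ c`, `4 ↦ d`. -/
def subst (a b c d : ℕ) : ℕ → ℕ
  | 1 => a
  | 2 => b
  | 3 => c
  | _ => d

theorem containsSeq_iff {n : ℕ} {s : Fin n → ℕ} {σ : List ℕ}
    (hσ : ∀ x, x ∈ σ ↔ x = 1 ∨ x = 2 ∨ x = 3 ∨ x = 4) :
    ContainsSeq s σ.get ↔
      ∃ a b c d, a < b ∧ b < c ∧ c < d ∧ σ.map (subst a b c d) <+ List.ofFn s := by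
  constructor
  · rintro ⟨f, hf, h⟩
    have hex : ∀ x, (x = 1 ∨ x = 2 ∨ x = 3 ∨ x = 4) → ∃ i, σ.get i = x := fun x hx =>
      List.mem_iff_get.1 ((hσ x).2 hx)
    obtain ⟨i₁, h₁⟩ := hex 1 (by simp)
    obtain ⟨i₂, h₂⟩ := hex 2 (by simp)
    obtain ⟨i₃, h₃⟩ := hex 3 (by simp)
    obtain ⟨i₄, h₄⟩ := hex 4 (by simp)
    refine ⟨s (f i₁), s (f i₂), s (f i₃), s (f i₄), (h _ _).2 (by omega), (h _ _).2 (by omega),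
      (h _ _).2 (by omega), ?_⟩
    -- Order-isomorphism in both directions also forces equal pattern letters to have equal images,
    -- so four values determine the occurrence.
    have heq : ∀ i j, σ.get i = σ.get j → s (f i) = s (f j) := by
      intro i j hij
      have h1 := h i j
      have h2 := h j i
      omega
    rw [List.sublist_iff_exists_fin_orderEmbedding_get_eq]
    refine ⟨OrderEmbedding.ofStrictMono
      (fun i => Fin.cast (by simp) (f (Fin.cast (by simp) i))) ?_, ?_⟩
    · intro i j hij
      exact hf (show Fin.cast _ i < Fin.cast _ j from hij)
    · intro i
      have key : ∀ j, subst (s (f i₁)) (s (f i₂)) (s (f i₃)) (s (f i₄)) (σ.get j) = s (f j) := by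
        intro j
        rcases (hσ _).1 (List.get_mem σ j) with hj | hj | hj | hj <;> rw [hj]
        · exact heq _ _ (h₁.trans hj.symm)
        · exact heq _ _ (h₂.trans hj.symm)
        · exact heq _ _ (h₃.trans hj.symm)
        · exact heq _ _ (h₄.trans hj.symm)
      have := key (Fin.cast (by simp) i)
      simp only [List.get_eq_getElem, List.getElem_map, List.getElem_ofFn]
      exact this
  · rintro ⟨a, b, c, d, hab, hbc, hcd, h⟩
    rw [List.sublist_iff_exists_fin_orderEmbedding_get_eq] at h
    obtain ⟨e, he⟩ := h
    have hs : ∀ i : Fin σ.length, s (Fin.cast (by simp) (e (Fin.cast (by simp) i))) =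
        subst a b c d (σ.get i) := by
      intro i
      have := he (Fin.cast (by simp) i)
      simp only [List.get_eq_getElem, List.getElem_map, List.getElem_ofFn, Fin.val_cast] at this
      exact this.symm
    refine ⟨fun i => Fin.cast (by simp) (e (Fin.cast (by simp) i)), ?_, ?_⟩
    · intro i j hij
      exact e.strictMono (show Fin.cast _ i < Fin.cast _ j from hij)
    · intro i j
      rw [hs, hs]
      rcases (hσ _).1 (List.get_mem σ i) with h1 | h1 | h1 | h1 <;>
        rcases (hσ _).1 (List.get_mem σ j) with h2 | h2 | h2 | h2 <;>
          rw [h1, h2] <;> simp only [subst] <;> omega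

theorem IsRGF.cons_sublist {w t : List ℕ} (hw : IsRGF w) {x y : ℕ} (hy : 1 ≤ y) (hyx : y < x)
    (h : x :: t <+ w) : y :: x :: t <+ w := by
  obtain ⟨r₁, r₂, rfl, hx, ht⟩ := List.cons_sublist_iff.1 h
  obtain ⟨u, v, rfl⟩ := List.append_of_mem hx
  have := (hw u x (v ++ r₂) (by simp)).2 y hy hyx
  have h1 := ((List.singleton_sublist.2 this).append
    (List.singleton_sublist.2 (List.mem_cons_self (a := x) (l := v)))).append ht
  simpa using h1

variable {left : Prop} {T : ℕ → ℕ → ℕ → List ℕ}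

/-- The growth condition puts `b + 1` before any larger `c`, so `c` can be lowered to `b + 1`.
Conversely it supplies the leading letters `s` and `k` before `k + 1`. -/
theorem exists_lowLevel_iff (hT : HasWild left T) {w : List ℕ} (hw : IsRGF w) :
    (∃ a b c d, a < b ∧ b < c ∧ c < d ∧ a :: b :: c :: T b a d <+ w) ↔ ∃ k, LowLevel T k w := by
  constructor
  · rintro ⟨a, b, c, d, hab, hbc, hcd, h⟩
    have h1 : c :: T b a d <+ w :=
      (List.sublist_cons_self b _).trans ((List.sublist_cons_self a _).trans h)
    refine ⟨b, a, d, hab, by omega, ?_⟩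
    rcases (Nat.succ_le_of_lt hbc).eq_or_lt with rfl | hlt
    · exact h1
    · exact (((List.sublist_cons_self c _).cons_cons _)).trans (hw.cons_sublist (by omega) hlt h1)
  · rintro ⟨k, s, r, hsk, hkr, h⟩
    have hs : 1 ≤ s := by
      obtain ⟨u, v, -, -, hT⟩ := hT.side k r
      exact hw.one_le (h.subset (by simp [hT]))
    exact ⟨s, k, k + 1, r, hsk, by omega, hkr,
      hw.cons_sublist hs hsk (hw.cons_sublist (by omega) (by omega) h)⟩

/-- The second letter is only required to lie strictly between `a` and `c`, so `k - 1` serves, and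
the growth condition supplies it together with the leading `r`. -/
theorem exists_highLevel_iff (hT : HasWild left T) {w : List ℕ} (hw : IsRGF w) :
    (∃ a b c d, a < b ∧ b < c ∧ c < d ∧ a :: b :: c :: T c d a <+ w) ↔ ∃ k, HighLevel T k w := by
  constructor
  · rintro ⟨a, b, c, d, hab, hbc, hcd, h⟩
    exact ⟨c, d, a, hcd, by omega,
      (List.sublist_cons_self b _).trans ((List.sublist_cons_self a _).trans h)⟩
  · rintro ⟨k, s, r, hks, hrk, h⟩
    have hr : 1 ≤ r := by
      obtain ⟨u, v, -, -, -, hT⟩ := hT.run k s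
      exact hw.one_le (h.subset (by simp [hT]))
    exact ⟨r, k - 1, k, s, by omega, by omega, hks,
      hw.cons_sublist hr (by omega) (hw.cons_sublist (by omega) (by omega) h)⟩

theorem avoidCount_low (hT : HasWild left T) {σ : List ℕ}
    (hσ : ∀ x, x ∈ σ ↔ x = 1 ∨ x = 2 ∨ x = 3 ∨ x = 4)
    (hmap : ∀ a b c d, σ.map (subst a b c d) = a :: b :: c :: T b a d) (n : ℕ) :
    avoidCount n σ =
      Nat.card {w : List ℕ // (IsRGF w ∧ w.length = n) ∧ ∀ k, ¬ LowLevel T k w} := by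
  refine card_part_eq (F := fun s => ¬ ContainsSeq s σ.get) fun s hs => ?_
  rw [containsSeq_iff hσ, ← not_exists]
  simp only [hmap]
  rw [exists_lowLevel_iff hT hs]

theorem avoidCount_high (hT : HasWild left T) {σ : List ℕ}
    (hσ : ∀ x, x ∈ σ ↔ x = 1 ∨ x = 2 ∨ x = 3 ∨ x = 4)
    (hmap : ∀ a b c d, σ.map (subst a b c d) = a :: b :: c :: T c d a) (n : ℕ) :
    avoidCount n σ =
      Nat.card {w : List ℕ // (IsRGF w ∧ w.length = n) ∧ ∀ k, ¬ HighLevel T k w} := by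
  refine card_part_eq (F := fun s => ¬ ContainsSeq s σ.get) fun s hs => ?_
  rw [containsSeq_iff hσ, ← not_exists]
  simp only [hmap]
  rw [exists_highLevel_iff hT hs]

end Containment
end SetPartition

theorem mainTheorem9 (p q : ℕ) :
    SetPartition.PatternEquiv
      ([1, 2, 3] ++ SetPartition.rep 2 p ++ [1, 4] ++ SetPartition.rep 2 q)
      ([1, 2, 3, 1] ++ SetPartition.rep 2 p ++ [4] ++ SetPartition.rep 2 q) ∧
    SetPartition.PatternEquiv
      ([1, 2, 3] ++ SetPartition.rep 2 p ++ [4, 1] ++ SetPartition.rep 2 q)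
      ([1, 2, 3] ++ SetPartition.rep 2 p ++ [4] ++ SetPartition.rep 2 q ++ [1]) ∧
    SetPartition.PatternEquiv
      ([1, 2] ++ SetPartition.rep 3 (p + 1) ++ [4, 1] ++ SetPartition.rep 3 q)
      ([1, 2, 3, 4] ++ SetPartition.rep 3 p ++ [1] ++ SetPartition.rep 3 q) ∧
    SetPartition.PatternEquiv
      ([1, 2] ++ SetPartition.rep 3 (p + 1) ++ [1, 4] ++ SetPartition.rep 3 q)
      ([1, 2] ++ SetPartition.rep 3 (p + 1) ++ [1] ++ SetPartition.rep 3 q ++ [4]) := by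
  refine ⟨fun n => ?_, fun n => ?_, fun n => ?_, fun n => ?_⟩
  · rw [SetPartition.avoidCount_low (SetPartition.hasWild_side_run p q) ?_ ?_ n,
      SetPartition.card_low_right,
      SetPartition.avoidCount_low (SetPartition.hasWild_side_first_run p q) ?_ ?_ n]
    all_goals first
      | intro x; simp [List.mem_replicate]; omega
      | intro a b c d; simp [SetPartition.subst]
  · rw [SetPartition.avoidCount_low (SetPartition.hasWild_run_side p q) ?_ ?_ n,
      SetPartition.card_low_left,
      SetPartition.avoidCount_low (SetPartition.hasWild_run_side_last p q) ?_ ?_ n]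
    all_goals first
      | intro x; simp [List.mem_replicate]; omega
      | intro a b c d; simp [SetPartition.subst]
  -- One of the `p + 1` copies of 3 is the leading `k` of the level, which leaves `p` copies for the
  -- shape.
  · rw [SetPartition.avoidCount_high (SetPartition.hasWild_side_run p q) ?_ ?_ n,
      SetPartition.card_high_right,
      SetPartition.avoidCount_high (SetPartition.hasWild_side_first_run p q) ?_ ?_ n]
    all_goals first
      | intro x; simp [List.mem_replicate]; omega
      | intro a b c d; simp [SetPartition.subst, List.replicate_succ]
  · rw [SetPartition.avoidCount_high (SetPartition.hasWild_run_side p q) ?_ ?_ n,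
      SetPartition.card_high_left,
      SetPartition.avoidCount_high (SetPartition.hasWild_run_side_last p q) ?_ ?_ n]
    all_goals first
      | intro x; simp [List.mem_replicate]; omega
      | intro a b c d; simp [SetPartition.subst, List.replicate_succ]
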